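/- Let $G=\mathrm{SL}_3(\mathbb R)$, $K=\mathrm{SO}(3)$, and let $X=G/K$ be the Riemannian symmetric space with base point $o=[K]$ and with the distance $d$ of the $G$-invariant Riemannian metric induced by the Killing form $B(x,y)=6\,\mathrm{Tr}(xy)$. Let $H$ be the identity component of $\mathrm{SO}(F)=\{g\in G: F\circ g=F\}$ for $F(x,y,z)=2xz-y^2$, and let $Y=Ho\subset X$, a totally geodesic plane. For $s,t\in\mathbb R$ put $$h_s=\mathrm{diag}(e^s,1,e^{-s}),\qquad a_t=\mathrm{diag}(e^t,e^{-2t},e^t),\qquad k_0=\begin{pmatrix}\frac12&\frac1{\sqrt2}&\frac12\\-\frac1{\sqrt2}&0&\frac1{\sqrt2}\\\frac12&-\frac1{\sqrt2}&\frac12\end{pmatrix},$$ and $A_0=\{h_s:s\in\mathbb R\}$. For a complete geodesic $L=hA_0o$ of $Y$ $(h\in H)$ let $Y_{L,t}=h\,a_tY$ be the floating plane over $L$; let $\gamma_t(s)=a_tk_0h_so$, which is a point of $Y_t:=a_tY=Y_{A_0o,t}$. For every $x\in X$ there is a unique point $\pi(x)\in Y$ with $d(x,\pi(x))=\inf_{y\in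 Y}d(x,y)$, and the nearest point projection $\pi:X\to Y$ so defined has the following properties. 1. For every complete geodesic $L=hA_0o$ of $Y$ (in particular for $L=A_0o$, $Y_{L,t}=Y_t$) and every $\varepsilon>0$, the union $\bigcup_{|t|>\varepsilon}\pi(Y_{L,t})$ lies within a bounded distance from $L$. 2. Let $(t_n)$, $(s_n)$ be sequences of real numbers. If $(t_n)$ is bounded and there is $\varepsilon>0$ with $|t_n|>\varepsilon$ for all $n$, then the sequence $\pi(\gamma_{t_n}(s_n))$ is bounded. If $(s_n)$ is bounded, then the sequence $\pi(\gamma_{t_n}(s_n))$ is bounded. -/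

import Mathlib

noncomputable section

namespace FloatingPlanes

/-- `G = SL₃(ℝ)`, with Mathlib's topology and group structure. -/
abbrev G : Type := Matrix.SpecialLinearGroup (Fin 3) ℝ

/-- `K = SO(3) = {g ∈ G : (gᵀ)⁻¹ = g}`. -/
def K : Subgroup G where
  carrier := {g | (g : Matrix (Fin 3) (Fin 3) ℝ) ∈ Matrix.orthogonalGroup (Fin 3) ℝ}
  mul_mem' {a b} ha hb := by
    simpa only [Set.mem_ofPred_eq, Matrix.SpecialLinearGroup.coe_mul] using mul_mem ha hb
  one_mem' := by
    simpa only [Set.mem_ofPred_eq, Matrix.SpecialLinearGroup.coe_one] using one_mem _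
  inv_mem' {g} hg := by
    have h1 : (g : Matrix (Fin 3) (Fin 3) ℝ) * star (g : Matrix (Fin 3) (Fin 3) ℝ) = 1 :=
      (Matrix.mem_orthogonalGroup_iff (Fin 3) ℝ).1 hg
    have h2 : ((g⁻¹ : G) : Matrix (Fin 3) (Fin 3) ℝ) * (g : Matrix (Fin 3) (Fin 3) ℝ) = 1 := by
      rw [← Matrix.SpecialLinearGroup.coe_mul, inv_mul_cancel, Matrix.SpecialLinearGroup.coe_one]
    have h3 : ((g⁻¹ : G) : Matrix (Fin 3) (Fin 3) ℝ) = star (g : Matrix (Fin 3) (Fin 3) ℝ) :=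
      left_inv_eq_right_inv h2 h1
    simpa only [Set.mem_ofPred_eq, h3] using Unitary.star_mem hg

/-- The symmetric space `X = G/K`. -/
abbrev X : Type := G ⧸ K

/-- The base point `o = [K]`. -/
def o : X := QuotientGroup.mk (1 : G)

/-- The Killing form `B(x, y) = 6 Tr(xy)` of `𝔰𝔩₃(ℝ)`. -/
def killing (x y : Matrix (Fin 3) (Fin 3) ℝ) : ℝ := 6 * (x * y).trace

/-- A `C¹` curve in `G` (its matrix entries are `C¹` functions). -/
def IsC1Curve (c : ℝ → G) : Prop :=
  ∀ i j, ContDiff ℝ 1 (fun τ => (c τ : Matrix (Fin 3) (Fin 3) ℝ) i j)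

/-- The left-translated velocity `c(τ)⁻¹ c'(τ) ∈ 𝔤` of a curve in `G`. -/
def velocity (c : ℝ → G) (τ : ℝ) : Matrix (Fin 3) (Fin 3) ℝ :=
  (((c τ)⁻¹ : G) : Matrix (Fin 3) (Fin 3) ℝ) *
    Matrix.of (fun i j => deriv (fun u => (c u : Matrix (Fin 3) (Fin 3) ℝ) i j) τ)

/-- The component of `x ∈ 𝔤 = 𝔨 ⊕ 𝔭` in `𝔭`, the symmetric matrices; `𝔭` is the tangent space
of `X` at `o`, and the projection is the differential of `G → X` at the identity. -/
def pPart (x : Matrix (Fin 3) (Fin 3) ℝ) : Matrix (Fin 3) (Fin 3) ℝ :=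
  (1 / 2 : ℝ) • (x + x.transpose)

/-- The Riemannian length of the curve `τ ↦ c(τ) o`, `0 ≤ τ ≤ 1`, in `X`, for the `G`-invariant
Riemannian metric which is the Killing form on `T_o X = 𝔭`. -/
def curveLength (c : ℝ → G) : ℝ :=
  ∫ τ in (0 : ℝ)..1, Real.sqrt (killing (pPart (velocity c τ)) (pPart (velocity c τ)))

/-- The Riemannian distance on `X`: the infimum of the lengths of `C¹` curves in `X` from `x`
to `y`. A `C¹` curve in `X` is the image of a `C¹` curve in `G`. -/
def dX (x y : X) : ℝ :=
  sInf {ℓ : ℝ | ∃ c : ℝ → G, IsC1Curve c ∧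
    (QuotientGroup.mk (c 0) : X) = x ∧ (QuotientGroup.mk (c 1) : X) = y ∧ curveLength c = ℓ}

/-- The quadratic form `F(x, y, z) = 2xz - y²`. -/
def F (v : Fin 3 → ℝ) : ℝ := 2 * v 0 * v 2 - v 1 ^ 2

/-- `SO(F)`, the subgroup of `G` preserving `F`. -/
def SOF : Subgroup G where
  carrier := {g | ∀ v : Fin 3 → ℝ, F ((g : Matrix (Fin 3) (Fin 3) ℝ).mulVec v) = F v}
  mul_mem' {a b} ha hb v := by
    rw [Matrix.SpecialLinearGroup.coe_mul, ← Matrix.mulVec_mulVec, ha, hb]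
  one_mem' v := by
    rw [Matrix.SpecialLinearGroup.coe_one, Matrix.one_mulVec]
  inv_mem' {g} hg v := by
    have h : (g : Matrix (Fin 3) (Fin 3) ℝ).mulVec
        (((g⁻¹ : G) : Matrix (Fin 3) (Fin 3) ℝ).mulVec v) = v := by
      rw [Matrix.mulVec_mulVec, ← Matrix.SpecialLinearGroup.coe_mul, mul_inv_cancel,
        Matrix.SpecialLinearGroup.coe_one, Matrix.one_mulVec]
    rw [← hg, h]

/-- `H`, the identity component of `SO(F)`. -/
def H : Subgroup G := (Subgroup.connectedComponentOfOne SOF).map SOF.subtype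

/-- The totally geodesic plane `Y = H o`. -/
def Y : Set X := {x | ∃ h ∈ H, x = h • o}

/-- `h_s = diag(eˢ, 1, e⁻ˢ)`; these elements form the group `A₀`. -/
def hDiag (s : ℝ) : G :=
  ⟨Matrix.diagonal ![Real.exp s, 1, Real.exp (-s)], by
    simp [Matrix.det_diagonal, Fin.prod_univ_three, ← Real.exp_add]⟩

/-- `a_t = diag(eᵗ, e⁻²ᵗ, eᵗ)`. -/
def aDiag (t : ℝ) : G :=
  ⟨Matrix.diagonal ![Real.exp t, Real.exp (-2 * t), Real.exp t], by
    simp only [Matrix.det_diagonal, Fin.prod_univ_three, Matrix.cons_val, ← Real.exp_add]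
    rw [← Real.exp_zero]
    congr 1
    ring⟩

/-- The quarter turn `k₀ ∈ H ∩ K`. -/
def k₀ : G :=
  ⟨!![1 / 2, 1 / Real.sqrt 2, 1 / 2;
      -(1 / Real.sqrt 2), 0, 1 / Real.sqrt 2;
      1 / 2, -(1 / Real.sqrt 2), 1 / 2], by
    have h : (1 / Real.sqrt 2) * (1 / Real.sqrt 2) = 1 / 2 := by
      rw [div_mul_div_comm, Real.mul_self_sqrt (by norm_num)]; norm_num
    rw [Matrix.det_fin_three]
    simp only [Matrix.of_apply, Matrix.cons_val]
    linear_combination 2 * h⟩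

/-- The complete geodesic `h A₀ o`. For `h ∈ H` these are the complete geodesics of `Y`. -/
def geodesic (h : G) : Set X := {x | ∃ s : ℝ, x = h • hDiag s • o}

/-- The floating plane `Y_{L,t} = h a_t Y` over the geodesic `L = h A₀ o`. -/
def floatingPlane (h : G) (t : ℝ) : Set X := {x | ∃ y ∈ Y, x = h • aDiag t • y}

/-- The point `γ_t(s) = a_t k₀ h_s o` of `Y_t = a_t Y`. -/
def γ (t s : ℝ) : X := aDiag t • k₀ • hDiag s • o

/-- `π` is the nearest point projection `X → Y`: for every `x`, the point `π x` of `Y` is the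
unique point of `Y` at minimal distance from `x`. This determines `π`. -/
def IsNearestPointProjection (π : X → X) : Prop :=
  ∀ x, π x ∈ Y ∧ ∀ y ∈ Y, y ≠ π x → dX x (π x) < dX x y

end FloatingPlanes

end

namespace FloatingPlanes

open Matrix NormedSpace Filter Set
open scoped Topology

/-! ### Symmetric matrices, their exponentials and logarithms -/

section SymmetricExponential

variable {n : Type*} [Fintype n]

/-! The point `g o` is encoded by the positive definite matrix P = g gᵀ of determinant 1, and P by
its symmetric logarithm. Distances are compared through logarithms. A curve is at least as long as
√(3/2) times the Frobenius distance between the logarithms of its ends (`frob_sub_le_dX`), and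
exponential curves issuing from `o` attain this bound (`dX_o_mk_le`). The source is
`trace_sub_sq_le`, an inequality between traces proved from two spectral decompositions, so the
logarithm never has to be differentiated.

Let J be the matrix of F. The points of Y are the positive definite S with S J S = J, whose
logarithms anticommute with J. A point whose logarithm commutes with J lies over `o` perpendicularly
to Y. The two kinds of logarithm are orthogonal for the trace form, so Pythagoras and the distance
comparison make such a foot the strictly nearest point (`dX_lt_of_isFoot`). A foot always exists
(`exists_isFoot`): it is the midpoint of P and its mirror image J P⁻¹ J, that is, the positive
solution S of S (J P J) S = P.

For a floating plane, translate the foot `h o` to `o`. The form h⁻¹ a_t J a_t h⁻ᵀ, which does not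
depend on the point of the plane, is e^{2t} J plus a multiple of n nᵀ, where n = h⁻¹ e₂. Since the
translated point commutes with J, the two eigenspaces of J are orthogonal for it and for its
inverse, and this yields one scalar equation (`foot_pairing`). Its signs force n to be bounded once
|t| > ε (`foot_bound`), and |n| controls the distance from `h o` to A₀o (`exists_hDiag_close`).

For γ_t(s) the foot is explicit: it is k₀ h_r o with tanh 2r = tanh 2s / cosh 3t (`gram_foot_γ`).
Both boundedness claims then amount to keeping this quotient away from ±1. -/

theorem trace_mul_self_of_isSymm {A : Matrix n n ℝ} (hA : A.IsSymm) :
    (A * A).trace = ∑ i, ∑ j, A i j ^ 2 := by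
  rw [trace]
  refine Finset.sum_congr rfl fun i _ => ?_
  rw [diag_apply, mul_apply]
  exact Finset.sum_congr rfl fun j _ => by rw [sq, hA.apply]

theorem eq_zero_of_trace_mul_self {A : Matrix n n ℝ} (hA : A.IsSymm) (h : (A * A).trace ≤ 0) :
    A = 0 := by
  rw [trace_mul_self_of_isSymm hA] at h
  have h2 : ∀ i, 0 ≤ ∑ j, A i j ^ 2 := fun i => Finset.sum_nonneg fun j _ => sq_nonneg _
  have h0 := le_antisymm h (Finset.sum_nonneg fun i _ => h2 i)
  ext i j
  have h1 := (Finset.sum_eq_zero_iff_of_nonneg fun i _ => h2 i).1 h0 i (Finset.mem_univ i)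
  have h3 := (Finset.sum_eq_zero_iff_of_nonneg fun j _ => sq_nonneg (A i j)).1 h1 j
    (Finset.mem_univ j)
  simpa using h3

variable [DecidableEq n]

/-- Orthogonal diagonalization of a real symmetric matrix. -/
theorem exists_orthogonal_diagonalization {A : Matrix n n ℝ} (hA : A.IsSymm) :
    ∃ U : Matrix n n ℝ, Uᵀ * U = 1 ∧ U * Uᵀ = 1 ∧ ∃ a : n → ℝ, A = U * diagonal a * Uᵀ := by
  have hH : A.IsHermitian := by rwa [IsHermitian, conjTranspose_eq_transpose_of_trivial]
  refine ⟨hH.eigenvectorUnitary, ?_, ?_, hH.eigenvalues, ?_⟩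
  · have := Unitary.coe_star_mul_self hH.eigenvectorUnitary
    rwa [star_eq_conjTranspose, conjTranspose_eq_transpose_of_trivial] at this
  · have := Unitary.coe_mul_star_self hH.eigenvectorUnitary
    rwa [Unitary.coe_star, star_eq_conjTranspose, conjTranspose_eq_transpose_of_trivial] at this
  · have := hH.spectral_theorem
    rw [Unitary.conjStarAlgAut_apply, star_eq_conjTranspose,
      conjTranspose_eq_transpose_of_trivial] at this
    simpa using this

theorem exp_conj_diagonal {U : Matrix n n ℝ} (h1 : Uᵀ * U = 1) (h2 : U * Uᵀ = 1) (a : n → ℝ) :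
    exp (U * diagonal a * Uᵀ) = U * diagonal (fun i => Real.exp (a i)) * Uᵀ := by
  have h := Matrix.exp_units_conj (⟨U, Uᵀ, h2, h1⟩ : (Matrix n n ℝ)ˣ) (diagonal a)
  simp only [Units.inv_mk] at h
  rw [h, Matrix.exp_diagonal, Pi.exp_def]
  simp only [Real.exp_eq_exp_ℝ]

theorem posDef_conj_diagonal {U : Matrix n n ℝ} (h1 : Uᵀ * U = 1) {a : n → ℝ}
    (ha : ∀ i, 0 < a i) : (U * diagonal a * Uᵀ).PosDef := by
  have hd : (diagonal a).PosDef := PosDef.diagonal ha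
  have h := hd.mul_mul_conjTranspose_same (B := U) (by
    intro x y hxy
    have := congrArg (fun v => v ᵥ* Uᵀ) hxy
    simpa [vecMul_vecMul, mul_eq_one_comm.1 h1] using this)
  rwa [conjTranspose_eq_transpose_of_trivial] at h

theorem posDef_exp {A : Matrix n n ℝ} (hA : A.IsSymm) : (exp A).PosDef := by
  obtain ⟨U, h1, h2, a, rfl⟩ := exists_orthogonal_diagonalization hA
  rw [exp_conj_diagonal h1 h2]
  exact posDef_conj_diagonal h1 fun i => Real.exp_pos _

/-- A positive definite matrix has a symmetric logarithm. -/
theorem exists_symm_log {P : Matrix n n ℝ} (hP : P.PosDef) :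
    ∃ A : Matrix n n ℝ, A.IsSymm ∧ exp A = P := by
  have hs : P.IsSymm := by
    have := hP.isHermitian
    rwa [IsHermitian, conjTranspose_eq_transpose_of_trivial] at this
  obtain ⟨U, h1, h2, a, rfl⟩ := exists_orthogonal_diagonalization hs
  have ha : ∀ i, 0 < a i := by
    have h := hP.conjTranspose_mul_mul_same (B := U) (by
      intro x y hxy
      have := congrArg (fun v => Uᵀ *ᵥ v) hxy
      simpa [mulVec_mulVec, h1] using this)
    have e : Uᴴ * (U * diagonal a * Uᵀ) * U = diagonal a := by
      rw [conjTranspose_eq_transpose_of_trivial,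
        show Uᵀ * (U * diagonal a * Uᵀ) * U = (Uᵀ * U) * diagonal a * (Uᵀ * U) by
          simp only [Matrix.mul_assoc], h1, Matrix.one_mul, Matrix.mul_one]
    rw [e] at h
    exact posDef_diagonal_iff.1 h
  refine ⟨U * diagonal (fun i => Real.log (a i)) * Uᵀ, ?_, ?_⟩
  · simp [IsSymm, transpose_mul, Matrix.mul_assoc]
  · rw [exp_conj_diagonal h1 h2]
    simp only [Real.exp_log (ha _)]

theorem det_exp_of_isSymm {A : Matrix n n ℝ} (hA : A.IsSymm) :
    (exp A).det = Real.exp A.trace := by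
  obtain ⟨U, h1, h2, a, rfl⟩ := exists_orthogonal_diagonalization hA
  have hd : U.det * Uᵀ.det = 1 := by rw [← det_mul, h2, det_one]
  rw [exp_conj_diagonal h1 h2, det_mul, det_mul, mul_right_comm, hd, one_mul, det_diagonal,
    trace_mul_comm, ← Matrix.mul_assoc, h1, Matrix.one_mul, trace_diagonal, Real.exp_sum]

/-- Two spectral decompositions are coupled by the squared entries of UᵀV. For orthogonal U and V
these weights are doubly stochastic, which reduces trace inequalities to scalar ones. -/
theorem trace_conj_diagonal_mul {U V : Matrix n n ℝ} (a b : n → ℝ) :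
    ((U * diagonal a * Uᵀ) * (V * diagonal b * Vᵀ)).trace =
      ∑ i, ∑ j, a i * b j * (Uᵀ * V) i j ^ 2 := by
  have e : ((U * diagonal a * Uᵀ) * (V * diagonal b * Vᵀ)).trace =
      ((diagonal a * (Uᵀ * V)) * (diagonal b * (Uᵀ * V)ᵀ)).trace := by
    rw [transpose_mul, transpose_transpose]
    simp only [Matrix.mul_assoc]
    rw [trace_mul_comm U]
    simp only [Matrix.mul_assoc]
  rw [e, trace]
  refine Finset.sum_congr rfl fun i _ => ?_
  rw [diag_apply, mul_apply]
  refine Finset.sum_congr rfl fun j _ => ?_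
  rw [diagonal_mul, diagonal_mul, transpose_apply]
  ring

theorem sq_le_exp_add_exp_neg (x : ℝ) : x ^ 2 ≤ Real.exp x + Real.exp (-x) - 2 := by
  have h1 : Real.sinh (x / 2) ^ 2 ≥ (x / 2) ^ 2 := by
    rcases le_total 0 x with h | h
    · have := Real.self_le_sinh_iff.2 (by linarith : 0 ≤ x / 2)
      exact pow_le_pow_left₀ (by linarith) this 2
    · have := Real.self_le_sinh_iff.2 (by linarith : 0 ≤ -(x / 2))
      rw [Real.sinh_neg] at this
      nlinarith
  have h2 : Real.cosh x = 1 + 2 * Real.sinh (x / 2) ^ 2 := by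
    have h3 := Real.cosh_two_mul (x / 2)
    rw [mul_div_cancel₀ x two_ne_zero, Real.cosh_sq] at h3
    linarith
  rw [Real.cosh_eq] at h2
  linarith

theorem sum_sq_eq_one_row {O : Matrix n n ℝ} (h : O * Oᵀ = 1) (i : n) : ∑ j, O i j ^ 2 = 1 := by
  have := congrFun (congrFun h i) i
  simpa [mul_apply, sq] using this

theorem trace_conj_diagonal_sq {U V : Matrix n n ℝ} (hU : Uᵀ * U = 1) (hV : V * Vᵀ = 1)
    (a : n → ℝ) :
    ((U * diagonal a * Uᵀ) * (U * diagonal a * Uᵀ)).trace =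
      ∑ i, ∑ j, a i ^ 2 * (Uᵀ * V) i j ^ 2 := by
  have hO : (Uᵀ * V) * (Uᵀ * V)ᵀ = 1 := by
    rw [transpose_mul, transpose_transpose, Matrix.mul_assoc, ← Matrix.mul_assoc V, hV,
      Matrix.one_mul, hU]
  have h1 : ((U * diagonal a * Uᵀ) * (U * diagonal a * Uᵀ)).trace = ∑ i, a i ^ 2 := by
    rw [show (U * diagonal a * Uᵀ) * (U * diagonal a * Uᵀ) =
      U * (diagonal a * (Uᵀ * U) * (diagonal a * Uᵀ)) by simp only [Matrix.mul_assoc], hU,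
      trace_mul_comm, Matrix.mul_one, Matrix.mul_assoc, Matrix.mul_assoc, hU, Matrix.mul_one,
      diagonal_mul_diagonal, trace_diagonal]
    simp only [sq]
  rw [h1]
  refine Finset.sum_congr rfl fun i _ => ?_
  rw [← Finset.mul_sum, sum_sq_eq_one_row hO, mul_one]

/-- The matrix logarithm does not increase distances, in a form without derivatives. -/
theorem trace_sub_sq_le {A B : Matrix n n ℝ} (hA : A.IsSymm) (hB : B.IsSymm) :
    ((A - B) * (A - B)).trace ≤
      (exp (-A) * exp B).trace + (exp (-B) * exp A).trace - 2 * Fintype.card n := by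
  obtain ⟨U, hU1, hU2, a, rfl⟩ := exists_orthogonal_diagonalization hA
  obtain ⟨V, hV1, hV2, b, rfl⟩ := exists_orthogonal_diagonalization hB
  have hO : (Uᵀ * V) * (Uᵀ * V)ᵀ = 1 := by
    rw [transpose_mul, transpose_transpose, Matrix.mul_assoc, ← Matrix.mul_assoc V, hV2,
      Matrix.one_mul, hU1]
  have hnA : -(U * diagonal a * Uᵀ) = U * diagonal (-a) * Uᵀ := by
    rw [show diagonal (-a) = -diagonal a from (diagonal_neg a).symm, Matrix.mul_neg,
      Matrix.neg_mul]
  have hnB : -(V * diagonal b * Vᵀ) = V * diagonal (-b) * Vᵀ := by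
    rw [show diagonal (-b) = -diagonal b from (diagonal_neg b).symm, Matrix.mul_neg,
      Matrix.neg_mul]
  have hsymm : ∀ i j, (Vᵀ * U) i j = (Uᵀ * V) j i := fun i j => by
    rw [← transpose_apply (Uᵀ * V), transpose_mul, transpose_transpose]
  have e1 : ((U * diagonal a * Uᵀ - V * diagonal b * Vᵀ) *
      (U * diagonal a * Uᵀ - V * diagonal b * Vᵀ)).trace =
      ∑ i, ∑ j, (a i - b j) ^ 2 * (Uᵀ * V) i j ^ 2 := by
    have hBB : ((V * diagonal b * Vᵀ) * (V * diagonal b * Vᵀ)).trace =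
        ∑ i, ∑ j, b j ^ 2 * (Uᵀ * V) i j ^ 2 := by
      rw [trace_conj_diagonal_sq hV1 hU2, Finset.sum_comm]
      simp only [hsymm]
    rw [sub_mul, mul_sub, mul_sub, trace_sub, trace_sub, trace_sub,
      trace_mul_comm (V * diagonal b * Vᵀ) (U * diagonal a * Uᵀ), hBB,
      trace_conj_diagonal_sq hU1 hV2, trace_conj_diagonal_mul, ← Finset.sum_sub_distrib,
      ← Finset.sum_sub_distrib, ← Finset.sum_sub_distrib]
    refine Finset.sum_congr rfl fun i _ => ?_
    rw [← Finset.sum_sub_distrib, ← Finset.sum_sub_distrib, ← Finset.sum_sub_distrib]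
    exact Finset.sum_congr rfl fun j _ => by ring
  have e2 : (2 : ℝ) * Fintype.card n = ∑ i, ∑ j, 2 * (Uᵀ * V) i j ^ 2 := by
    simp only [← Finset.mul_sum, sum_sq_eq_one_row hO]
    simp
  rw [hnA, hnB, exp_conj_diagonal hU1 hU2, exp_conj_diagonal hV1 hV2, exp_conj_diagonal hU1 hU2,
    exp_conj_diagonal hV1 hV2, trace_mul_comm (V * _ * _), trace_conj_diagonal_mul,
    trace_conj_diagonal_mul, e1, e2, ← Finset.sum_add_distrib, ← Finset.sum_sub_distrib]
  -- All terms are now sums against the same nonnegative weights (UᵀV)ᵢⱼ², so the scalar inequality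
  -- x² ≤ eˣ + e⁻ˣ - 2 at x = aᵢ - bⱼ suffices.
  refine Finset.sum_le_sum fun i _ => ?_
  rw [← Finset.sum_add_distrib, ← Finset.sum_sub_distrib]
  refine Finset.sum_le_sum fun j _ => ?_
  have h := mul_le_mul_of_nonneg_right (sq_le_exp_add_exp_neg (a i - b j))
    (sq_nonneg ((Uᵀ * V) i j))
  have x1 : Real.exp ((-a) i) * Real.exp (b j) = Real.exp (-(a i - b j)) := by
    rw [← Real.exp_add]; congr 1; simp; ring
  have x2 : Real.exp (a i) * Real.exp ((-b) j) = Real.exp (a i - b j) := by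
    rw [← Real.exp_add]; congr 1
  rw [x1, x2]
  linarith

theorem exp_neg_mul_exp (A : Matrix n n ℝ) : exp (-A) * exp A = 1 := by
  rw [← Matrix.exp_add_of_commute _ _ (Commute.refl A).neg_left, neg_add_cancel, exp_zero]

/-- When the exponentials agree, the right-hand side of `trace_sub_sq_le` is n + n - 2n = 0. -/
theorem exp_injective_of_isSymm {A B : Matrix n n ℝ} (hA : A.IsSymm) (hB : B.IsSymm)
    (h : exp A = exp B) : A = B := by
  have h1 := trace_sub_sq_le hA hB
  rw [← h, exp_neg_mul_exp, h, exp_neg_mul_exp, trace_one] at h1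
  exact sub_eq_zero.1 (eq_zero_of_trace_mul_self (hA.sub hB) (by linarith))

/-- Uniqueness of positive definite square roots. -/
theorem posDef_mul_self_injective {S T : Matrix n n ℝ} (hS : S.PosDef) (hT : T.PosDef)
    (h : S * S = T * T) : S = T := by
  obtain ⟨A, hA, rfl⟩ := exists_symm_log hS
  obtain ⟨B, hB, rfl⟩ := exists_symm_log hT
  rw [← sq, ← sq, ← Matrix.exp_nsmul, ← Matrix.exp_nsmul] at h
  have h2 := exp_injective_of_isSymm (hA.smul 2) (hB.smul 2) h
  have h3 : A = B := by
    ext i j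
    have := congrFun (congrFun h2 i) j
    rw [Matrix.smul_apply, Matrix.smul_apply, two_nsmul, two_nsmul] at this
    linarith
  rw [h3]

theorem exp_half_mul_self (A : Matrix n n ℝ) :
    exp ((1 / 2 : ℝ) • A) * exp ((1 / 2 : ℝ) • A) = exp A := by
  rw [← Matrix.exp_add_of_commute _ _ rfl, ← add_smul]
  norm_num

end SymmetricExponential

/-! ### Points of X as positive definite matrices -/

/-- The positive definite matrix `g gᵀ` attached to the point `g o` of `X`. -/
def gram (g : G) : Matrix (Fin 3) (Fin 3) ℝ :=
  (g : Matrix (Fin 3) (Fin 3) ℝ) * (g : Matrix (Fin 3) (Fin 3) ℝ)ᵀ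

theorem coe_inv_mul_coe (g : G) :
    ((g⁻¹ : G) : Matrix (Fin 3) (Fin 3) ℝ) * (g : Matrix (Fin 3) (Fin 3) ℝ) = 1 := by
  rw [← Matrix.SpecialLinearGroup.coe_mul, inv_mul_cancel, Matrix.SpecialLinearGroup.coe_one]

theorem coe_mul_coe_inv (g : G) :
    (g : Matrix (Fin 3) (Fin 3) ℝ) * ((g⁻¹ : G) : Matrix (Fin 3) (Fin 3) ℝ) = 1 := by
  rw [← Matrix.SpecialLinearGroup.coe_mul, mul_inv_cancel, Matrix.SpecialLinearGroup.coe_one]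

theorem coe_transpose_mul_inv_transpose (g : G) :
    (g : Matrix (Fin 3) (Fin 3) ℝ)ᵀ * ((g⁻¹ : G) : Matrix (Fin 3) (Fin 3) ℝ)ᵀ = 1 := by
  rw [← transpose_mul, coe_inv_mul_coe, transpose_one]

theorem coe_inv_transpose_mul_transpose (g : G) :
    ((g⁻¹ : G) : Matrix (Fin 3) (Fin 3) ℝ)ᵀ * (g : Matrix (Fin 3) (Fin 3) ℝ)ᵀ = 1 := by
  rw [← transpose_mul, coe_mul_coe_inv, transpose_one]

theorem gram_mul (g h : G) : gram (g * h) =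
    (g : Matrix (Fin 3) (Fin 3) ℝ) * gram h * (g : Matrix (Fin 3) (Fin 3) ℝ)ᵀ := by
  simp only [gram, Matrix.SpecialLinearGroup.coe_mul, transpose_mul, Matrix.mul_assoc]

theorem gram_isSymm (g : G) : (gram g).IsSymm := by
  simp [IsSymm, gram, transpose_mul]

theorem posDef_gram (g : G) : (gram g).PosDef := by
  have h := PosDef.one.mul_mul_conjTranspose_same (B := (g : Matrix (Fin 3) (Fin 3) ℝ)) (by
    intro x y hxy
    have := congrArg (fun v => v ᵥ* ((g⁻¹ : G) : Matrix (Fin 3) (Fin 3) ℝ)) hxy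
    simpa only [vecMul_vecMul, coe_mul_coe_inv, vecMul_one] using this)
  rwa [conjTranspose_eq_transpose_of_trivial, Matrix.mul_one] at h

theorem det_gram (g : G) : (gram g).det = 1 := by
  rw [gram, det_mul, det_transpose, g.det_coe, mul_one]

theorem mk_eq_mk_iff {g h : G} :
    (QuotientGroup.mk g : X) = QuotientGroup.mk h ↔ gram g = gram h := by
  have h1 : g⁻¹ * h ∈ K ↔ gram (g⁻¹ * h) = 1 := by
    change ((g⁻¹ * h : G) : Matrix (Fin 3) (Fin 3) ℝ) ∈ Matrix.orthogonalGroup (Fin 3) ℝ ↔ _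
    rw [mem_orthogonalGroup_iff, gram]
  rw [QuotientGroup.eq, h1]
  constructor
  · intro e
    have : gram h = gram (g * (g⁻¹ * h)) := by rw [mul_inv_cancel_left]
    rw [this, gram_mul, e, Matrix.mul_one, gram]
  · intro e
    rw [gram_mul, ← e, ← gram_mul, inv_mul_cancel, gram, Matrix.SpecialLinearGroup.coe_one,
      transpose_one, Matrix.mul_one]

theorem smul_mk (g h : G) :
    g • (QuotientGroup.mk h : X) = QuotientGroup.mk (g * h) := rfl

theorem smul_o (g : G) : g • o = QuotientGroup.mk g := by
  rw [o, smul_mk, mul_one]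

/-- The inverse of `gram g`. -/
theorem gram_inv_transpose (g : G) :
    (((g⁻¹ : G) : Matrix (Fin 3) (Fin 3) ℝ)ᵀ * ((g⁻¹ : G) : Matrix (Fin 3) (Fin 3) ℝ)) * gram g
      = 1 := by
  rw [gram, Matrix.mul_assoc, ← Matrix.mul_assoc _ _ (_)ᵀ, coe_inv_mul_coe, Matrix.one_mul,
    coe_inv_transpose_mul_transpose]

/-- The Frobenius norm of a matrix. -/
noncomputable def frob (A : Matrix (Fin 3) (Fin 3) ℝ) : ℝ := √(∑ i, ∑ j, A i j ^ 2)

theorem frob_nonneg (A : Matrix (Fin 3) (Fin 3) ℝ) : 0 ≤ frob A := Real.sqrt_nonneg _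

theorem frob_sq {A : Matrix (Fin 3) (Fin 3) ℝ} (hA : A.IsSymm) : frob A ^ 2 = (A * A).trace := by
  rw [trace_mul_self_of_isSymm hA, frob, Real.sq_sqrt]
  positivity

theorem frob_eq_norm (A : Matrix (Fin 3) (Fin 3) ℝ) :
    frob A = ‖WithLp.toLp 2 (fun p : Fin 3 × Fin 3 => A p.1 p.2)‖ := by
  rw [EuclideanSpace.norm_eq, frob, Fintype.sum_prod_type]
  simp

theorem frob_sub_comm (A B : Matrix (Fin 3) (Fin 3) ℝ) : frob (A - B) = frob (B - A) := by
  simp only [frob, Matrix.sub_apply, sub_sq_comm]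

theorem abs_frob_sub_frob_le (A B : Matrix (Fin 3) (Fin 3) ℝ) :
    |frob A - frob B| ≤ frob (A - B) := by
  rw [frob_eq_norm, frob_eq_norm, frob_eq_norm]
  exact abs_norm_sub_norm_le _ _

/-! ### Lengths of curves against distances of logarithms -/

/-- The matrix of derivatives of the entries of a curve. -/
noncomputable def derivMatrix (c : ℝ → G) (τ : ℝ) : Matrix (Fin 3) (Fin 3) ℝ :=
  Matrix.of (fun i j => deriv (fun u => (c u : Matrix (Fin 3) (Fin 3) ℝ) i j) τ)

section Curves

variable {c : ℝ → G}

theorem IsC1Curve.continuous_coe (hc : IsC1Curve c) :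
    Continuous fun τ => (c τ : Matrix (Fin 3) (Fin 3) ℝ) :=
  continuous_matrix fun i j => (hc i j).continuous

theorem IsC1Curve.continuous_inv (hc : IsC1Curve c) :
    Continuous fun τ => (((c τ)⁻¹ : G) : Matrix (Fin 3) (Fin 3) ℝ) := by
  simp only [Matrix.SpecialLinearGroup.coe_inv]
  exact hc.continuous_coe.matrix_adjugate

theorem IsC1Curve.continuous_derivMatrix (hc : IsC1Curve c) : Continuous (derivMatrix c) :=
  continuous_matrix fun i j => (hc i j).continuous_deriv le_rfl

theorem IsC1Curve.continuous_speed (hc : IsC1Curve c) :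
    Continuous fun τ => √(killing (pPart (velocity c τ)) (pPart (velocity c τ))) := by
  have hv : Continuous (velocity c) := hc.continuous_inv.matrix_mul hc.continuous_derivMatrix
  have hp : Continuous fun τ => pPart (velocity c τ) :=
    (hv.add hv.matrix_transpose).const_smul (1 / 2 : ℝ)
  exact (continuous_const.mul (hp.matrix_mul hp).matrix_trace).sqrt

theorem IsC1Curve.tendsto_slope (hc : IsC1Curve c) (x : ℝ) :
    Tendsto (fun z => (z - x)⁻¹ • ((c z : Matrix (Fin 3) (Fin 3) ℝ) - (c x : Matrix (Fin 3) (Fin 3) ℝ))) (𝓝[>] x)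
      (𝓝 (derivMatrix c x)) := by
  refine tendsto_pi_nhds.2 fun i => tendsto_pi_nhds.2 fun j => ?_
  have hd := (((hc i j).differentiable one_ne_zero) x).hasDerivAt
  refine (hd.tendsto_slope.mono_left (nhdsWithin_mono x fun z hz => ne_of_gt hz)).congr fun z => ?_
  simp [slope_def_field, div_eq_inv_mul]

end Curves

/-- Rewrites the bound of `trace_sub_sq_le` as an expression quadratic in the increment of `gram`,
so that dividing by the square of the time step leaves a finite limit. -/
theorem trace_gram_identity (g h : G) :
    ((((g⁻¹ : G) : Matrix (Fin 3) (Fin 3) ℝ)ᵀ * ((g⁻¹ : G) : Matrix (Fin 3) (Fin 3) ℝ)) *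
        gram h).trace +
      ((((h⁻¹ : G) : Matrix (Fin 3) (Fin 3) ℝ)ᵀ * ((h⁻¹ : G) : Matrix (Fin 3) (Fin 3) ℝ)) *
        gram g).trace - 2 * Fintype.card (Fin 3) =
    ((((g⁻¹ : G) : Matrix (Fin 3) (Fin 3) ℝ)ᵀ * ((g⁻¹ : G) : Matrix (Fin 3) (Fin 3) ℝ)) *
        (gram h - gram g) *
      ((((h⁻¹ : G) : Matrix (Fin 3) (Fin 3) ℝ)ᵀ * ((h⁻¹ : G) : Matrix (Fin 3) (Fin 3) ℝ)) *
        (gram h - gram g))).trace := by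
  have hg := gram_inv_transpose g
  have hh := gram_inv_transpose h
  set P := ((g⁻¹ : G) : Matrix (Fin 3) (Fin 3) ℝ)ᵀ * ((g⁻¹ : G) : Matrix (Fin 3) (Fin 3) ℝ)
  set Q := ((h⁻¹ : G) : Matrix (Fin 3) (Fin 3) ℝ)ᵀ * ((h⁻¹ : G) : Matrix (Fin 3) (Fin 3) ℝ)
  have hh' : gram h * Q = 1 := mul_eq_one_comm.1 hh
  have e : P * gram h * (Q * gram g) = 1 := by
    rw [Matrix.mul_assoc, ← Matrix.mul_assoc (gram h), hh', Matrix.one_mul, hg]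
  rw [Matrix.mul_sub, Matrix.mul_sub, hg, hh, sub_mul, mul_sub, mul_sub, e, Matrix.mul_one,
    Matrix.one_mul, Matrix.one_mul, trace_sub, trace_sub, trace_sub, trace_one]
  ring

theorem exp_neg_of_exp_eq_gram {A : Matrix (Fin 3) (Fin 3) ℝ} {g : G} (h : exp A = gram g) :
    exp (-A) =
      ((g⁻¹ : G) : Matrix (Fin 3) (Fin 3) ℝ)ᵀ * ((g⁻¹ : G) : Matrix (Fin 3) (Fin 3) ℝ) := by
  have h1 := exp_neg_mul_exp A
  rw [h] at h1
  exact left_inv_eq_right_inv h1 (mul_eq_one_comm.1 (gram_inv_transpose g))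

theorem frob_sub_sq_le {A B : Matrix (Fin 3) (Fin 3) ℝ} (hA : A.IsSymm) (hB : B.IsSymm) {g h : G}
    (hg : exp A = gram g) (hh : exp B = gram h) :
    frob (B - A) ^ 2 ≤
    ((((g⁻¹ : G) : Matrix (Fin 3) (Fin 3) ℝ)ᵀ * ((g⁻¹ : G) : Matrix (Fin 3) (Fin 3) ℝ)) *
        (gram h - gram g) *
      ((((h⁻¹ : G) : Matrix (Fin 3) (Fin 3) ℝ)ᵀ * ((h⁻¹ : G) : Matrix (Fin 3) (Fin 3) ℝ)) *
        (gram h - gram g))).trace := by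
  rw [← trace_gram_identity, frob_sub_comm, frob_sq (hA.sub hB),
    ← exp_neg_of_exp_eq_gram hg, ← exp_neg_of_exp_eq_gram hh, ← hg, ← hh]
  exact trace_sub_sq_le hA hB

/-- The matrix differentiated here is (c cᵀ)'. Conjugated back to the identity it is W = v + vᵀ,
twice the 𝔭-part of the velocity v. Hence tr W² is 4 times the trace form of that part, and 4/6 =
2/3 of the Killing form. -/
theorem trace_speed (c : ℝ → G) (x : ℝ) :
    ((((c x)⁻¹ : G) : Matrix (Fin 3) (Fin 3) ℝ)ᵀ * (((c x)⁻¹ : G) : Matrix (Fin 3) (Fin 3) ℝ) *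
      (derivMatrix c x * (c x : Matrix (Fin 3) (Fin 3) ℝ)ᵀ +
        (c x : Matrix (Fin 3) (Fin 3) ℝ) * (derivMatrix c x)ᵀ) *
      ((((c x)⁻¹ : G) : Matrix (Fin 3) (Fin 3) ℝ)ᵀ * (((c x)⁻¹ : G) : Matrix (Fin 3) (Fin 3) ℝ) *
      (derivMatrix c x * (c x : Matrix (Fin 3) (Fin 3) ℝ)ᵀ +
        (c x : Matrix (Fin 3) (Fin 3) ℝ) * (derivMatrix c x)ᵀ))).trace =
    2 / 3 * killing (pPart (velocity c x)) (pPart (velocity c x)) := by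
  have h1 : derivMatrix c x = (c x : Matrix (Fin 3) (Fin 3) ℝ) * velocity c x := by
    change _ = _ * (_ * derivMatrix c x)
    rw [← Matrix.mul_assoc, coe_mul_coe_inv, Matrix.one_mul]
  have h2 : derivMatrix c x * (c x : Matrix (Fin 3) (Fin 3) ℝ)ᵀ +
        (c x : Matrix (Fin 3) (Fin 3) ℝ) * (derivMatrix c x)ᵀ =
      (c x : Matrix (Fin 3) (Fin 3) ℝ) * (velocity c x + (velocity c x)ᵀ) *
        (c x : Matrix (Fin 3) (Fin 3) ℝ)ᵀ := by
    rw [h1, transpose_mul, Matrix.mul_add, Matrix.add_mul, Matrix.mul_assoc, Matrix.mul_assoc]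
  rw [h2]
  set W := velocity c x + (velocity c x)ᵀ with hW
  have h3 : (((c x)⁻¹ : G) : Matrix (Fin 3) (Fin 3) ℝ)ᵀ *
      (((c x)⁻¹ : G) : Matrix (Fin 3) (Fin 3) ℝ) *
      ((c x : Matrix (Fin 3) (Fin 3) ℝ) * W * (c x : Matrix (Fin 3) (Fin 3) ℝ)ᵀ) =
      (((c x)⁻¹ : G) : Matrix (Fin 3) (Fin 3) ℝ)ᵀ * W * (c x : Matrix (Fin 3) (Fin 3) ℝ)ᵀ := by
    rw [Matrix.mul_assoc, Matrix.mul_assoc, ← Matrix.mul_assoc _ (c x).1, coe_inv_mul_coe,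
      Matrix.one_mul, Matrix.mul_assoc]
  rw [h3]
  have h4 : (((c x)⁻¹ : G) : Matrix (Fin 3) (Fin 3) ℝ)ᵀ * W * (c x : Matrix (Fin 3) (Fin 3) ℝ)ᵀ *
      ((((c x)⁻¹ : G) : Matrix (Fin 3) (Fin 3) ℝ)ᵀ * W * (c x : Matrix (Fin 3) (Fin 3) ℝ)ᵀ) =
      (((c x)⁻¹ : G) : Matrix (Fin 3) (Fin 3) ℝ)ᵀ * (W * W * (c x : Matrix (Fin 3) (Fin 3) ℝ)ᵀ) := by
    simp only [Matrix.mul_assoc]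
    rw [← Matrix.mul_assoc (c x).1ᵀ, coe_transpose_mul_inv_transpose, Matrix.one_mul]
  rw [h4, trace_mul_comm, Matrix.mul_assoc, coe_transpose_mul_inv_transpose, Matrix.mul_one,
    killing, pPart, smul_mul_smul_comm, trace_smul, ← hW, smul_eq_mul]
  ring

/-- Distances between logarithms are bounded by the lengths of curves. -/
theorem frob_sub_le_curveLength {c : ℝ → G} (hc : IsC1Curve c) {A B : Matrix (Fin 3) (Fin 3) ℝ}
    (hA : A.IsSymm) (hB : B.IsSymm) (h0 : exp A = gram (c 0)) (h1 : exp B = gram (c 1)) :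
    frob (B - A) ≤ √(2 / 3) * curveLength c := by
  -- The logarithms are chosen pointwise. Continuity of the distance to A and the bound on its
  -- slopes both come from `frob_sub_sq_le`, so L need not be known to be differentiable.
  choose L hLs hL using fun τ => exists_symm_log (posDef_gram (c τ))
  have hL0 : L 0 = A := exp_injective_of_isSymm (hLs 0) hA ((hL 0).trans h0.symm)
  have hL1 : L 1 = B := exp_injective_of_isSymm (hLs 1) hB ((hL 1).trans h1.symm)
  set v : ℝ → ℝ := fun τ => √(killing (pPart (velocity c τ)) (pPart (velocity c τ))) with hv
  have hvc : Continuous v := hc.continuous_speed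
  have hcc := hc.continuous_coe
  have hci := hc.continuous_inv
  have hgram : Continuous fun τ => gram (c τ) := hcc.matrix_mul hcc.matrix_transpose
  have hpi : Continuous fun τ => ((((c τ)⁻¹ : G) : Matrix (Fin 3) (Fin 3) ℝ)ᵀ *
      (((c τ)⁻¹ : G) : Matrix (Fin 3) (Fin 3) ℝ)) := hci.matrix_transpose.matrix_mul hci
  have hdist : ∀ x z, |frob (L z - A) - frob (L x - A)| ≤ frob (L z - L x) := fun x z => by
    have := abs_frob_sub_frob_le (L z - A) (L x - A)
    rwa [sub_sub_sub_cancel_right] at this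
  have hLc : Continuous fun τ => frob (L τ - A) := by
    refine continuous_iff_continuousAt.2 fun x => ?_
    rw [ContinuousAt, tendsto_iff_dist_tendsto_zero]
    have hz : Continuous fun z =>
        ((((((c x)⁻¹ : G) : Matrix (Fin 3) (Fin 3) ℝ)ᵀ *
          (((c x)⁻¹ : G) : Matrix (Fin 3) (Fin 3) ℝ)) * (gram (c z) - gram (c x)) *
        (((((c z)⁻¹ : G) : Matrix (Fin 3) (Fin 3) ℝ)ᵀ *
          (((c z)⁻¹ : G) : Matrix (Fin 3) (Fin 3) ℝ)) * (gram (c z) - gram (c x)))).trace) :=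
      ((continuous_const.matrix_mul (hgram.sub continuous_const)).matrix_mul
        (hpi.matrix_mul (hgram.sub continuous_const))).matrix_trace
    have hz0 := hz.sqrt.tendsto x
    simp only [sub_self, Matrix.mul_zero, trace_zero, Real.sqrt_zero] at hz0
    exact squeeze_zero (fun _ => dist_nonneg)
      (fun z => (hdist x z).trans <| Real.le_sqrt_of_sq_le (frob_sub_sq_le (hLs x) (hLs z) (hL x) (hL z))) hz0
  have hslope : ∀ x, ∀ r, √(2 / 3) * v x < r →
      ∃ᶠ z in 𝓝[>] x, slope (fun τ => frob (L τ - A)) x z < r := by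
    intro x r hr
    have hD : Tendsto (fun z => (z - x)⁻¹ • (gram (c z) - gram (c x))) (𝓝[>] x)
        (𝓝 (derivMatrix c x * (c x : Matrix (Fin 3) (Fin 3) ℝ)ᵀ +
          (c x : Matrix (Fin 3) (Fin 3) ℝ) * (derivMatrix c x)ᵀ)) := by
      have hs := hc.tendsto_slope x
      have ht : Tendsto (fun z => (c z : Matrix (Fin 3) (Fin 3) ℝ)ᵀ) (𝓝[>] x)
          (𝓝 (c x : Matrix (Fin 3) (Fin 3) ℝ)ᵀ) :=
        (hcc.matrix_transpose.tendsto x).mono_left nhdsWithin_le_nhds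
      have hst : Tendsto (fun z => ((z - x)⁻¹ • ((c z : Matrix (Fin 3) (Fin 3) ℝ) - (c x : Matrix (Fin 3) (Fin 3) ℝ)))ᵀ)
          (𝓝[>] x) (𝓝 (derivMatrix c x)ᵀ) :=
        ((continuous_id.matrix_transpose).tendsto (derivMatrix c x)).comp hs
      refine ((hs.mul ht).add (tendsto_const_nhds.mul hst)).congr fun z => ?_
      rw [Matrix.smul_mul, transpose_smul, Matrix.mul_smul, ← smul_add, gram, gram,
        Matrix.sub_mul, transpose_sub, Matrix.mul_sub]
      congr 1
      abel
    have hpx : Tendsto (fun z => (((c z)⁻¹ : G) : Matrix (Fin 3) (Fin 3) ℝ)ᵀ *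
      (((c z)⁻¹ : G) : Matrix (Fin 3) (Fin 3) ℝ)) (𝓝[>] x) (𝓝 _) :=
        (hpi.tendsto x).mono_left nhdsWithin_le_nhds
    have hT := ((continuous_id.matrix_trace).tendsto _).comp
      (((tendsto_const_nhds (x := (((c x)⁻¹ : G) : Matrix (Fin 3) (Fin 3) ℝ)ᵀ *
        (((c x)⁻¹ : G) : Matrix (Fin 3) (Fin 3) ℝ))).mul hD).mul (hpx.mul hD))
    simp only [id] at hT
    rw [trace_speed] at hT
    have hT2 := (Real.continuous_sqrt.tendsto _).comp hT
    rw [Real.sqrt_mul (by norm_num)] at hT2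
    refine Eventually.frequently ?_
    filter_upwards [hT2.eventually (gt_mem_nhds hr), self_mem_nhdsWithin] with z hz hxz
    have hxz' : 0 < z - x := sub_pos.2 hxz
    refine lt_of_le_of_lt ?_ hz
    rw [slope_def_field]
    have h2 : frob (L z - A) - frob (L x - A) ≤ frob (L z - L x) :=
      (le_abs_self _).trans (hdist x z)
    refine (div_le_div_of_nonneg_right h2 hxz'.le).trans (Real.le_sqrt_of_sq_le ?_)
    rw [div_pow]
    simp only [Function.comp, Matrix.mul_smul, Matrix.smul_mul, smul_smul, trace_smul,
      smul_eq_mul]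
    rw [div_eq_inv_mul, sq (z - x), mul_inv]
    exact mul_le_mul_of_nonneg_left (frob_sub_sq_le (hLs x) (hLs z) (hL x) (hL z)) (by positivity)
  -- Mean value inequality needing only upper bounds for right slopes: |L(τ) - A| grows no faster
  -- than √(2/3) times the arc length.
  have key := image_le_of_liminf_slope_right_le_deriv_boundary (f := fun τ => frob (L τ - A))
    (a := 0) (b := 1) (B := fun τ => √(2 / 3) * ∫ u in (0 : ℝ)..τ, v u)
    (B' := fun τ => √(2 / 3) * v τ) hLc.continuousOn
    (by simp [hL0, frob])
    ((continuous_const.mul (intervalIntegral.continuous_primitive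
      (fun a b => hvc.intervalIntegrable a b) 0)).continuousOn)
    (fun x _ => ((intervalIntegral.integral_hasDerivAt_right (hvc.intervalIntegrable 0 x)
      (hvc.stronglyMeasurableAtFilter _ _) hvc.continuousAt).const_mul _).hasDerivWithinAt)
    (fun x _ r hr => hslope x r hr) (right_mem_Icc.2 zero_le_one)
  rw [← hL1]
  exact key

/-! ### Exponential curves and the invariant distance -/

/-- The element `exp A` of `G`, for a symmetric matrix `A` of trace zero. -/
noncomputable def expG (A : Matrix (Fin 3) (Fin 3) ℝ) (hA : A.IsSymm) (h0 : A.trace = 0) : G :=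
  ⟨exp A, by rw [det_exp_of_isSymm hA, h0, Real.exp_zero]⟩

theorem gram_expG {A : Matrix (Fin 3) (Fin 3) ℝ} (hA : A.IsSymm) (h0 : A.trace = 0) :
    gram (expG A hA h0) = exp ((2 : ℝ) • A) := by
  change exp A * (exp A)ᵀ = _
  rw [← Matrix.exp_transpose, hA, ← Matrix.exp_add_of_commute _ _ rfl, two_smul]

section

open scoped Matrix.Norms.Frobenius

theorem hasDerivAt_exp_line (A : Matrix (Fin 3) (Fin 3) ℝ) (α δ τ : ℝ) (i j : Fin 3) :
    HasDerivAt (fun u : ℝ => exp ((α + u * δ) • A) i j)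
      ((exp ((α + τ * δ) • A) * (δ • A)) i j) τ := by
  have h1 := hasDerivAt_exp_smul_const (𝕂 := ℝ) A (α + τ * δ)
  have h2 : HasDerivAt (fun u : ℝ => α + u * δ) δ τ := by
    simpa using ((hasDerivAt_id τ).mul_const δ).const_add α
  have h3 := h1.scomp τ h2
  have h4 := (hasDerivAt_pi.1 ((hasDerivAt_pi.1 h3) i)) j
  rw [Matrix.mul_smul]
  exact h4

theorem continuous_exp_line (A : Matrix (Fin 3) (Fin 3) ℝ) (α δ : ℝ) :
    Continuous fun u : ℝ => exp ((α + u * δ) • A) :=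
  NormedSpace.exp_continuous.comp (by fun_prop)

end

theorem exists_exp_curve {A : Matrix (Fin 3) (Fin 3) ℝ} (hA : A.IsSymm) (h0 : A.trace = 0)
    (α β : ℝ) : ∃ c : ℝ → G, IsC1Curve c ∧
      (∀ τ, (c τ : Matrix (Fin 3) (Fin 3) ℝ) = exp ((α + τ * (β - α)) • A)) ∧
      curveLength c = √6 * |β - α| * frob A := by
  have hs : ∀ r : ℝ, (r • A).IsSymm := fun r => hA.smul r
  have ht : ∀ r : ℝ, (r • A).trace = 0 := fun r => by rw [trace_smul, h0, smul_zero]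
  refine ⟨fun τ => expG ((α + τ * (β - α)) • A) (hs _) (ht _), ?_, fun τ => rfl, ?_⟩
  · intro i j
    have hd := fun τ => hasDerivAt_exp_line A α (β - α) τ i j
    rw [show (1 : WithTop ℕ∞) = 0 + 1 from rfl, contDiff_succ_iff_deriv]
    refine ⟨fun τ => (hd τ).differentiableAt, by simp, ?_⟩
    rw [contDiff_zero]
    have : deriv (fun u : ℝ => exp ((α + u * (β - α)) • A) i j) =
        fun τ => (exp ((α + τ * (β - α)) • A) * ((β - α) • A)) i j :=
      funext fun τ => (hd τ).deriv
    change Continuous (deriv (fun u : ℝ => exp ((α + u * (β - α)) • A) i j))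
    rw [this]
    exact ((continuous_exp_line A α (β - α)).matrix_mul continuous_const).matrix_elem i j
  · have hv : ∀ τ, velocity (fun τ => expG ((α + τ * (β - α)) • A) (hs _) (ht _)) τ =
        (β - α) • A := by
      intro τ
      have hm : Matrix.of (fun i j => deriv (fun u => ((expG ((α + u * (β - α)) • A) (hs _)
          (ht _) : G) : Matrix (Fin 3) (Fin 3) ℝ) i j) τ) =
          ((expG ((α + τ * (β - α)) • A) (hs _) (ht _) : G) : Matrix (Fin 3) (Fin 3) ℝ) *
            ((β - α) • A) := by
        ext i j
        exact (hasDerivAt_exp_line A α (β - α) τ i j).deriv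
      rw [velocity, hm, ← Matrix.mul_assoc, coe_inv_mul_coe, Matrix.one_mul]
    have hp : pPart ((β - α) • A) = (β - α) • A := by
      rw [pPart, hs (β - α), ← two_smul ℝ ((β - α) • A), smul_smul]
      norm_num
    have hk : √(killing ((β - α) • A) ((β - α) • A)) = √6 * |β - α| * frob A := by
      rw [killing, smul_mul_smul_comm, trace_smul, smul_eq_mul, ← frob_sq hA,
        Real.sqrt_mul (by norm_num), Real.sqrt_mul (mul_self_nonneg _),
        Real.sqrt_sq (frob_nonneg A), Real.sqrt_mul_self_eq_abs, mul_assoc]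
    rw [curveLength]
    simp only [hv, hp, hk]
    simp

theorem curveLength_nonneg (c : ℝ → G) : 0 ≤ curveLength c :=
  intervalIntegral.integral_nonneg zero_le_one fun _ _ => Real.sqrt_nonneg _

theorem dX_le_curveLength {c : ℝ → G} (hc : IsC1Curve c) {x y : X}
    (hx : (QuotientGroup.mk (c 0) : X) = x) (hy : (QuotientGroup.mk (c 1) : X) = y) :
    dX x y ≤ curveLength c :=
  csInf_le ⟨0, by rintro _ ⟨c, _, _, _, rfl⟩; exact curveLength_nonneg c⟩ ⟨c, hc, hx, hy, rfl⟩

theorem IsC1Curve.mul_left {c : ℝ → G} (hc : IsC1Curve c) (g : G) :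
    IsC1Curve fun τ => g * c τ := by
  intro i j
  simp only [Matrix.SpecialLinearGroup.coe_mul, mul_apply]
  exact ContDiff.sum fun k _ => contDiff_const.mul (hc k j)

theorem velocity_mul_left {c : ℝ → G} (hc : IsC1Curve c) (g : G) (τ : ℝ) :
    velocity (fun τ => g * c τ) τ = velocity c τ := by
  have hm : Matrix.of (fun i j => deriv (fun u => ((g * c u : G) :
      Matrix (Fin 3) (Fin 3) ℝ) i j) τ) = (g : Matrix (Fin 3) (Fin 3) ℝ) * derivMatrix c τ := by
    ext i j
    simp only [Matrix.SpecialLinearGroup.coe_mul, mul_apply, of_apply, derivMatrix]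
    have hd : ∀ k, HasDerivAt (fun u => (c u : Matrix (Fin 3) (Fin 3) ℝ) k j)
        (deriv (fun u => (c u : Matrix (Fin 3) (Fin 3) ℝ) k j) τ) τ := fun k =>
      ((hc k j).differentiable one_ne_zero τ).hasDerivAt
    exact (HasDerivAt.fun_sum fun k _ => (hd k).const_mul _).deriv
  rw [velocity, hm, _root_.mul_inv_rev, Matrix.SpecialLinearGroup.coe_mul, Matrix.mul_assoc,
    ← Matrix.mul_assoc _ (g : Matrix (Fin 3) (Fin 3) ℝ), coe_inv_mul_coe, Matrix.one_mul]
  rfl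

/-- The distance is `G`-invariant. -/
theorem dX_smul_smul (g : G) (x y : X) : dX (g • x) (g • y) = dX x y := by
  have key : ∀ (g : G) (x y : X) (ℓ : ℝ), (∃ c : ℝ → G, IsC1Curve c ∧
      (QuotientGroup.mk (c 0) : X) = x ∧ (QuotientGroup.mk (c 1) : X) = y ∧ curveLength c = ℓ) →
      ∃ c : ℝ → G, IsC1Curve c ∧ (QuotientGroup.mk (c 0) : X) = g • x ∧
        (QuotientGroup.mk (c 1) : X) = g • y ∧ curveLength c = ℓ := by
    rintro g x y ℓ ⟨c, hc, rfl, rfl, rfl⟩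
    refine ⟨fun τ => g * c τ, hc.mul_left g, rfl, rfl, ?_⟩
    simp only [curveLength, velocity_mul_left hc]
  unfold dX
  congr 1
  ext ℓ
  refine ⟨fun h => ?_, key g x y ℓ⟩
  have := key g⁻¹ _ _ ℓ h
  rwa [inv_smul_smul, inv_smul_smul] at this

theorem trace_eq_zero_of_exp_eq_gram {A : Matrix (Fin 3) (Fin 3) ℝ} (hA : A.IsSymm) {g : G}
    (h : exp A = gram g) : A.trace = 0 := by
  have := det_exp_of_isSymm hA
  rw [h, det_gram] at this
  exact (Real.exp_eq_one_iff _).1 this.symm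

/-- The curve is exp of multiples of A/2, because `gram` squares a symmetric element. Free end
parameters allow it to be run in both directions, so no symmetry of `dX` is required. -/
theorem exists_curve_from_log {A : Matrix (Fin 3) (Fin 3) ℝ} (hA : A.IsSymm) {g : G}
    (h : exp A = gram g) (α β : ℝ) : ∃ c : ℝ → G, IsC1Curve c ∧
      (α = 0 → (QuotientGroup.mk (c 0) : X) = o) ∧ (β = 0 → (QuotientGroup.mk (c 1) : X) = o) ∧
      (α = 1 → (QuotientGroup.mk (c 0) : X) = QuotientGroup.mk g) ∧
      (β = 1 → (QuotientGroup.mk (c 1) : X) = QuotientGroup.mk g) ∧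
      curveLength c = √(3 / 2) * |β - α| * frob A := by
  have hs : ((1 / 2 : ℝ) • A).IsSymm := hA.smul _
  have ht : ((1 / 2 : ℝ) • A).trace = 0 := by
    rw [trace_smul, trace_eq_zero_of_exp_eq_gram hA h, smul_zero]
  obtain ⟨c, hc, he, hl⟩ := exists_exp_curve hs ht α β
  have hone : gram (1 : G) = 1 := by
    rw [gram, Matrix.SpecialLinearGroup.coe_one, transpose_one, Matrix.mul_one]
  have hg0 : ∀ τ, α + τ * (β - α) = 0 → (QuotientGroup.mk (c τ) : X) = o := by
    intro τ e
    rw [o, mk_eq_mk_iff, hone, gram, he, e, zero_smul, exp_zero, transpose_one, Matrix.mul_one]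
  have hg1 : ∀ τ, α + τ * (β - α) = 1 → (QuotientGroup.mk (c τ) : X) = QuotientGroup.mk g := by
    intro τ e
    rw [mk_eq_mk_iff, ← h, gram, he, e, one_smul, ← Matrix.exp_transpose, hs, exp_half_mul_self]
  refine ⟨c, hc, fun e => hg0 0 (by simp [e]), fun e => hg0 1 (by simp [e]),
    fun e => hg1 0 (by simp [e]), fun e => hg1 1 (by simp [e]), ?_⟩
  have h2 : frob ((1 / 2 : ℝ) • A) = 1 / 2 * frob A := by
    rw [← sq_eq_sq₀ (frob_nonneg _) (by have := frob_nonneg A; positivity), frob_sq hs, mul_pow,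
      frob_sq hA, smul_mul_smul_comm, trace_smul, smul_eq_mul]
    ring
  -- The 6 is the factor in the Killing form and the 1/2 is the passage from A to A/2.
  have h3 : √6 * (1 / 2) = √(3 / 2) := by
    rw [show (6 : ℝ) = 3 / 2 * 2 ^ 2 by norm_num, Real.sqrt_mul (by norm_num),
      Real.sqrt_sq (by norm_num)]
    ring
  rw [hl, h2, ← h3]
  ring

theorem dX_o_mk_le {A : Matrix (Fin 3) (Fin 3) ℝ} (hA : A.IsSymm) {g : G}
    (h : exp A = gram g) : dX o (QuotientGroup.mk g) ≤ √(3 / 2) * frob A := by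
  obtain ⟨c, hc, h0, -, -, h1, hl⟩ := exists_curve_from_log hA h 0 1
  have := dX_le_curveLength hc (h0 rfl) (h1 rfl)
  rw [hl] at this
  simpa using this

theorem dX_mk_o_le {A : Matrix (Fin 3) (Fin 3) ℝ} (hA : A.IsSymm) {g : G}
    (h : exp A = gram g) : dX (QuotientGroup.mk g) o ≤ √(3 / 2) * frob A := by
  obtain ⟨c, hc, -, h1, h0, -, hl⟩ := exists_curve_from_log hA h 1 0
  have := dX_le_curveLength hc (h0 rfl) (h1 rfl)
  rw [hl] at this
  simpa using this

/-- The exponential map of `X` at the base point does not decrease distances. -/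
theorem frob_sub_le_dX {A B : Matrix (Fin 3) (Fin 3) ℝ} (hA : A.IsSymm) (hB : B.IsSymm) {g h : G}
    (hg : exp A = gram g) (hh : exp B = gram h) :
    √(3 / 2) * frob (B - A) ≤ dX (QuotientGroup.mk g) (QuotientGroup.mk h) := by
  refine le_csInf ?_ ?_
  · obtain ⟨C, hC, hCe⟩ := exists_symm_log (posDef_gram (g⁻¹ * h))
    obtain ⟨c, hc, h0, -, -, h1, -⟩ := exists_curve_from_log hC hCe 0 1
    refine ⟨_, fun τ => g * c τ, hc.mul_left g, ?_, ?_, rfl⟩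
    · rw [← smul_mk, h0 rfl, smul_o]
    · rw [← smul_mk, h1 rfl, smul_mk, mul_inv_cancel_left]
  · rintro _ ⟨c, hc, h0, h1, rfl⟩
    have := frob_sub_le_curveLength hc hA hB (hg.trans (mk_eq_mk_iff.1 h0).symm)
      (hh.trans (mk_eq_mk_iff.1 h1).symm)
    calc √(3 / 2) * frob (B - A) ≤ √(3 / 2) * (√(2 / 3) * curveLength c) := by gcongr
      _ = curveLength c := by
        rw [← mul_assoc, ← Real.sqrt_mul (by norm_num)]
        norm_num

/-- A bound for a logarithm in terms of traces. -/
theorem frob_sq_le_trace {A : Matrix (Fin 3) (Fin 3) ℝ} (hA : A.IsSymm) :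
    frob A ^ 2 ≤ (exp A).trace + (exp (-A)).trace := by
  have h := trace_sub_sq_le hA (isSymm_zero (α := ℝ) (n := Fin 3))
  rw [sub_zero, neg_zero, exp_zero, Matrix.mul_one, Matrix.one_mul] at h
  rw [frob_sq hA]
  simp at h
  linarith

/-! ### The form J, the group H and the plane Y -/

/-- The matrix of the quadratic form `F`. -/
def formJ : Matrix (Fin 3) (Fin 3) ℝ := !![0, 0, 1; 0, -1, 0; 1, 0, 0]

theorem formJ_mul_self : formJ * formJ = 1 := by
  ext i j
  fin_cases i <;> fin_cases j <;> simp [formJ, mul_apply, Fin.sum_univ_three]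

theorem formJ_transpose : formJᵀ = formJ := by
  ext i j
  fin_cases i <;> fin_cases j <;> simp [formJ]

theorem formJ_mul_formJ_mul (A : Matrix (Fin 3) (Fin 3) ℝ) : formJ * (formJ * A) = A := by
  rw [← Matrix.mul_assoc, formJ_mul_self, Matrix.one_mul]

theorem F_eq (v : Fin 3 → ℝ) : F v = v ⬝ᵥ formJ *ᵥ v := by
  simp [F, formJ, dotProduct, mulVec, Fin.sum_univ_three]
  ring

theorem F_mulVec (g : Matrix (Fin 3) (Fin 3) ℝ) (v : Fin 3 → ℝ) :
    F (g *ᵥ v) = v ⬝ᵥ (gᵀ * formJ * g) *ᵥ v := by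
  rw [F_eq, ← mulVec_mulVec, ← mulVec_mulVec, dotProduct_mulVec v, vecMul_transpose]

/-- A symmetric matrix is determined by its quadratic form. -/
theorem eq_of_dotProduct_mulVec {A B : Matrix (Fin 3) (Fin 3) ℝ} (hA : A.IsSymm) (hB : B.IsSymm)
    (h : ∀ v, v ⬝ᵥ A *ᵥ v = v ⬝ᵥ B *ᵥ v) : A = B := by
  ext i j
  have h1 := h (Pi.single i 1 + Pi.single j 1)
  have h2 := h (Pi.single i 1)
  have h3 := h (Pi.single j 1)
  simp [mulVec_add, add_dotProduct, dotProduct_add] at h1 h2 h3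
  have h4 := hA.apply i j
  have h5 := hB.apply i j
  linarith

theorem mem_SOF_iff {g : G} : g ∈ SOF ↔
    (g : Matrix (Fin 3) (Fin 3) ℝ)ᵀ * formJ * (g : Matrix (Fin 3) (Fin 3) ℝ) = formJ := by
  change (∀ v : Fin 3 → ℝ, F ((g : Matrix (Fin 3) (Fin 3) ℝ).mulVec v) = F v) ↔ _
  constructor
  · intro h
    refine eq_of_dotProduct_mulVec ?_ formJ_transpose fun v => ?_
    · simp [IsSymm, transpose_mul, formJ_transpose, Matrix.mul_assoc]
    · rw [← F_mulVec, h, F_eq]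
  · intro h v
    rw [F_mulVec, h, F_eq]

theorem mem_SOF_of_mem_H {g : G} (h : g ∈ H) : g ∈ SOF := by
  obtain ⟨x, -, rfl⟩ := h
  exact x.2

theorem transpose_mul_formJ_mul {h : G} (hh : h ∈ H) :
    (h : Matrix (Fin 3) (Fin 3) ℝ)ᵀ * formJ * (h : Matrix (Fin 3) (Fin 3) ℝ) = formJ :=
  mem_SOF_iff.1 (mem_SOF_of_mem_H hh)

theorem mul_formJ_mul_transpose {h : G} (hh : h ∈ H) :
    (h : Matrix (Fin 3) (Fin 3) ℝ) * formJ * (h : Matrix (Fin 3) (Fin 3) ℝ)ᵀ = formJ := by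
  have h1 := transpose_mul_formJ_mul hh
  have h2 : (formJ * (h : Matrix (Fin 3) (Fin 3) ℝ)ᵀ * formJ) * (h : Matrix (Fin 3) (Fin 3) ℝ)
      = 1 := by
    rw [Matrix.mul_assoc formJ, Matrix.mul_assoc formJ, h1, formJ_mul_self]
  have h3 := mul_eq_one_comm.1 h2
  calc (h : Matrix (Fin 3) (Fin 3) ℝ) * formJ * (h : Matrix (Fin 3) (Fin 3) ℝ)ᵀ
      = (h : Matrix (Fin 3) (Fin 3) ℝ) *
        (formJ * (h : Matrix (Fin 3) (Fin 3) ℝ)ᵀ * formJ) * formJ := by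
        simp only [Matrix.mul_assoc, formJ_mul_self, Matrix.mul_one]
    _ = formJ := by rw [h3, Matrix.one_mul]

theorem gram_mul_formJ_mul_gram {h : G} (hh : h ∈ H) : gram h * formJ * gram h = formJ := by
  calc gram h * formJ * gram h = (h : Matrix (Fin 3) (Fin 3) ℝ) *
      ((h : Matrix (Fin 3) (Fin 3) ℝ)ᵀ * formJ * (h : Matrix (Fin 3) (Fin 3) ℝ)) *
      (h : Matrix (Fin 3) (Fin 3) ℝ)ᵀ := by simp only [gram, Matrix.mul_assoc]
    _ = formJ := by rw [transpose_mul_formJ_mul hh, mul_formJ_mul_transpose hh]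

theorem exp_formJ_conj (A : Matrix (Fin 3) (Fin 3) ℝ) :
    exp (formJ * A * formJ) = formJ * exp A * formJ :=
  Matrix.exp_units_conj (⟨formJ, formJ, formJ_mul_self, formJ_mul_self⟩ :
    (Matrix (Fin 3) (Fin 3) ℝ)ˣ) A

theorem isSymm_formJ_conj {A : Matrix (Fin 3) (Fin 3) ℝ} (hA : A.IsSymm) :
    (formJ * A * formJ).IsSymm := by
  rw [IsSymm, transpose_mul, transpose_mul, formJ_transpose, hA, Matrix.mul_assoc]

/-- Conjugation by J inverts exp(rA), so every exp(rA) preserves F. The path r ↦ exp(rA) then joins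
1 to exp A inside `SOF`. -/
theorem expG_mem_H {A : Matrix (Fin 3) (Fin 3) ℝ} (hA : A.IsSymm) (h0 : A.trace = 0)
    (hJ : formJ * A * formJ = -A) : expG A hA h0 ∈ H := by
  have hs : ∀ r : ℝ, (r • A).IsSymm := fun r => hA.smul r
  have ht : ∀ r : ℝ, (r • A).trace = 0 := fun r => by rw [trace_smul, h0, smul_zero]
  have hm : ∀ r : ℝ, expG (r • A) (hs r) (ht r) ∈ SOF := by
    intro r
    rw [mem_SOF_iff]
    change (exp (r • A))ᵀ * formJ * exp (r • A) = formJ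
    have e1 : formJ * exp (r • A) * formJ = exp (-(r • A)) := by
      rw [← exp_formJ_conj, Matrix.mul_smul, Matrix.smul_mul, hJ, smul_neg]
    have e2 : formJ * exp (r • A) = exp (-(r • A)) * formJ := by
      rw [← e1, Matrix.mul_assoc, formJ_mul_self, Matrix.mul_one]
    have e3 : exp (r • A) * exp (-(r • A)) = 1 := mul_eq_one_comm.1 (exp_neg_mul_exp _)
    rw [← Matrix.exp_transpose, hs r, Matrix.mul_assoc, e2, ← Matrix.mul_assoc, e3,
      Matrix.one_mul]
  let p : ℝ → SOF := fun r => ⟨expG (r • A) (hs r) (ht r), hm r⟩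
  have hp : Continuous p := by
    refine Continuous.subtype_mk (Continuous.subtype_mk ?_ _) _
    simpa using continuous_exp_line A 0 1
  have hp0 : p 0 = 1 := by
    refine Subtype.ext (Subtype.ext ?_)
    change exp ((0 : ℝ) • A) = 1
    rw [zero_smul, exp_zero]
  have hsub := (isPreconnected_univ.image p hp.continuousOn).subset_connectedComponent
    (x := 1) ⟨0, trivial, hp0⟩
  refine ⟨p 1, hsub ⟨1, trivial, rfl⟩, Subtype.ext ?_⟩
  change exp ((1 : ℝ) • A) = exp A
  rw [one_smul]

/-- The hypothesis says J S J = S⁻¹; take symmetric logarithms of both sides. -/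
theorem formJ_conj_log {S W : Matrix (Fin 3) (Fin 3) ℝ} (hW : W.IsSymm) (hS : exp W = S)
    (h : S * formJ * S = formJ) : formJ * W * formJ = -W := by
  refine exp_injective_of_isSymm (isSymm_formJ_conj hW) hW.neg ?_
  have h1 : (formJ * exp W * formJ) * exp W = 1 := by
    rw [hS, Matrix.mul_assoc, Matrix.mul_assoc, ← Matrix.mul_assoc S, h, formJ_mul_self]
  rw [exp_formJ_conj]
  exact left_inv_eq_right_inv h1 (mul_eq_one_comm.1 (exp_neg_mul_exp W))

/-- The positive definite matrices `S` with `S J S = J` are the points of `Y`. -/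
theorem exists_mem_H_gram_eq {S : Matrix (Fin 3) (Fin 3) ℝ} (hS : S.PosDef)
    (h : S * formJ * S = formJ) : ∃ g ∈ H, gram g = S := by
  obtain ⟨W, hW, hWS⟩ := exists_symm_log hS
  have hJ := formJ_conj_log hW hWS h
  have ht : W.trace = 0 := by
    have := congrArg trace hJ
    rw [trace_mul_comm, formJ_mul_formJ_mul, trace_neg] at this
    linarith
  have hs : ((1 / 2 : ℝ) • W).IsSymm := hW.smul _
  have ht2 : ((1 / 2 : ℝ) • W).trace = 0 := by rw [trace_smul, ht, smul_zero]
  refine ⟨expG _ hs ht2, expG_mem_H hs ht2 ?_, ?_⟩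
  · rw [Matrix.mul_smul, Matrix.smul_mul, hJ, smul_neg]
  · rw [gram_expG, smul_smul, ← hWS]
    norm_num

/-! ### Perpendiculars and the nearest point projection -/

/-- The point `h o` of `Y` is the foot of the perpendicular from `g o`. -/
def IsFoot (g h : G) : Prop := formJ * gram (h⁻¹ * g) * formJ = gram (h⁻¹ * g)

/-- Move the foot to `o`. The logarithm A of the moved point commutes with J and the logarithm B ≠ 0
of the competitor anticommutes with it, so tr(BA) = 0 and |A| < |B - A|. Radial distances are at
most √(3/2)|A|, and all others at least √(3/2)|B - A|. -/
theorem dX_lt_of_isFoot {g h : G} (hh : h ∈ H) (hf : IsFoot g h) {y : X} (hy : y ∈ Y)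
    (hne : y ≠ QuotientGroup.mk h) :
    dX (QuotientGroup.mk g) (QuotientGroup.mk h) < dX (QuotientGroup.mk g) y := by
  obtain ⟨k, hk, rfl⟩ := hy
  rw [smul_o] at hne ⊢
  rw [← dX_smul_smul h⁻¹, ← dX_smul_smul h⁻¹ _ (QuotientGroup.mk k), smul_mk, smul_mk, smul_mk,
    inv_mul_cancel]
  have hk1 : h⁻¹ * k ∈ H := H.mul_mem (H.inv_mem hh) hk
  obtain ⟨A, hA, hAe⟩ := exists_symm_log (posDef_gram (h⁻¹ * g))
  obtain ⟨B, hB, hBe⟩ := exists_symm_log (posDef_gram (h⁻¹ * k))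
  have hJA : formJ * A * formJ = A := by
    refine exp_injective_of_isSymm (isSymm_formJ_conj hA) hA ?_
    rw [exp_formJ_conj, hAe, hf]
  have hJB := formJ_conj_log hB hBe (gram_mul_formJ_mul_gram hk1)
  have hAB : (B * A).trace = 0 := by
    have h1 : (formJ * B * formJ) * (formJ * A * formJ) = formJ * (B * A * formJ) := by
      simp only [Matrix.mul_assoc, formJ_mul_formJ_mul]
    rw [hJA, hJB] at h1
    have h2 := congrArg trace h1
    rw [trace_mul_comm formJ, Matrix.mul_assoc, formJ_mul_self, Matrix.mul_one, Matrix.neg_mul,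
      trace_neg] at h2
    linarith
  have hB0 : 0 < (B * B).trace := by
    by_contra hcon
    have hB' := eq_zero_of_trace_mul_self hB (not_lt.1 hcon)
    rw [hB', exp_zero] at hBe
    apply hne
    rw [mk_eq_mk_iff, show k = h * (h⁻¹ * k) by rw [mul_inv_cancel_left], gram_mul, ← hBe,
      Matrix.mul_one, gram]
  have hlt : frob A < frob (B - A) := by
    rw [← sq_lt_sq₀ (frob_nonneg _) (frob_nonneg _), frob_sq hA, frob_sq (hB.sub hA), sub_mul,
      mul_sub, mul_sub, trace_sub, trace_sub, trace_sub, trace_mul_comm A B, hAB]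
    linarith
  calc _ ≤ √(3 / 2) * frob A := dX_mk_o_le hA hAe
    _ < √(3 / 2) * frob (B - A) := by gcongr
    _ ≤ _ := frob_sub_le_dX hA hB hAe hBe

theorem inv_mul_formJ {h : G} (hh : h ∈ H) :
    ((h⁻¹ : G) : Matrix (Fin 3) (Fin 3) ℝ) * formJ = formJ * (h : Matrix (Fin 3) (Fin 3) ℝ)ᵀ := by
  calc _ = ((h⁻¹ : G) : Matrix (Fin 3) (Fin 3) ℝ) * ((h : Matrix (Fin 3) (Fin 3) ℝ) *
        formJ * (h : Matrix (Fin 3) (Fin 3) ℝ)ᵀ) := by rw [mul_formJ_mul_transpose hh]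
    _ = _ := by
      rw [Matrix.mul_assoc, ← Matrix.mul_assoc, coe_inv_mul_coe, Matrix.one_mul]

/-- The equation says that `gram h` is the midpoint of P = `gram g` and its mirror image J P⁻¹ J.
After translation by h⁻¹ the midpoint is `o`, and the equation becomes commutation with J. -/
theorem isFoot_of_gram {g h : G} (hh : h ∈ H)
    (e : gram h * (formJ * gram g * formJ) * gram h = gram g) : IsFoot g h := by
  have e1 := inv_mul_formJ hh
  have e2 : formJ * ((h⁻¹ : G) : Matrix (Fin 3) (Fin 3) ℝ) =
      (h : Matrix (Fin 3) (Fin 3) ℝ)ᵀ * formJ := by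
    rw [← formJ_mul_formJ_mul ((h : Matrix (Fin 3) (Fin 3) ℝ)ᵀ * formJ),
      ← Matrix.mul_assoc formJ _ formJ, ← e1, Matrix.mul_assoc, formJ_mul_self, Matrix.mul_one]
  have e3 := congrArg transpose e2
  rw [transpose_mul, transpose_mul, transpose_transpose, formJ_transpose] at e3
  have e4 : gram (h⁻¹ * g) = (h : Matrix (Fin 3) (Fin 3) ℝ)ᵀ * (formJ * gram g * formJ) *
      (h : Matrix (Fin 3) (Fin 3) ℝ) := by
    conv_lhs => rw [gram_mul, ← e]
    simp only [gram, Matrix.mul_assoc]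
    rw [← Matrix.mul_assoc _ (h : Matrix (Fin 3) (Fin 3) ℝ), coe_inv_mul_coe, Matrix.one_mul,
      coe_transpose_mul_inv_transpose, Matrix.mul_one]
  rw [IsFoot, gram_mul]
  calc formJ * (((h⁻¹ : G) : Matrix (Fin 3) (Fin 3) ℝ) * gram g *
        ((h⁻¹ : G) : Matrix (Fin 3) (Fin 3) ℝ)ᵀ) * formJ
      = (formJ * ((h⁻¹ : G) : Matrix (Fin 3) (Fin 3) ℝ)) * gram g *
        (((h⁻¹ : G) : Matrix (Fin 3) (Fin 3) ℝ)ᵀ * formJ) := by simp only [Matrix.mul_assoc]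
    _ = gram (h⁻¹ * g) := by rw [e2, e3, e4]; simp only [Matrix.mul_assoc]
    _ = _ := gram_mul _ _

theorem posDef_conj {S B C : Matrix (Fin 3) (Fin 3) ℝ} (hS : S.PosDef) (hB : B * C = 1) :
    (B * S * Bᵀ).PosDef := by
  have h := hS.mul_mul_conjTranspose_same (B := B) (by
    intro x y hxy
    have := congrArg (fun v => v ᵥ* C) hxy
    simpa only [vecMul_vecMul, hB, vecMul_one] using this)
  rwa [conjTranspose_eq_transpose_of_trivial] at h

/-- Every point of `X` has a foot on `Y`: the midpoint of the point and its mirror image. -/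
theorem exists_isFoot (g : G) : ∃ h ∈ H, IsFoot g h := by
  set a : Matrix (Fin 3) (Fin 3) ℝ := (g : Matrix (Fin 3) (Fin 3) ℝ)
  set b : Matrix (Fin 3) (Fin 3) ℝ := ((g⁻¹ : G) : Matrix (Fin 3) (Fin 3) ℝ)
  have hab : a * b = 1 := coe_mul_coe_inv g
  -- `M = m mᵀ` with `m = J g` is the mirror image of `gram g`, up to inversion
  have hm : (formJ * a) * (b * formJ) = 1 := by
    rw [Matrix.mul_assoc, ← Matrix.mul_assoc a, hab, Matrix.one_mul, formJ_mul_self]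
  have hm' : (b * formJ) * (formJ * a) = 1 := mul_eq_one_comm.1 hm
  have hmt : (formJ * a)ᵀ = aᵀ * formJ := by rw [transpose_mul, formJ_transpose]
  have hmit : (b * formJ)ᵀ = formJ * bᵀ := by rw [transpose_mul, formJ_transpose]
  have hm1 : (aᵀ * formJ) * (formJ * bᵀ) = 1 := by
    rw [← hmt, ← hmit, ← transpose_mul, hm', transpose_one]
  have hm2 : (formJ * bᵀ) * (aᵀ * formJ) = 1 := mul_eq_one_comm.1 hm1
  -- With m = J a and T = mᵀ S m, the equation S (m mᵀ) S = P becomes T² = mᵀ P m. So S is obtained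
  -- from a positive square root T, and its uniqueness from that of T.
  have hPD : ((aᵀ * formJ) * gram g * (formJ * a)).PosDef := by
    have := posDef_conj (posDef_gram g) hm1
    rwa [← hmt, transpose_transpose, hmt] at this
  obtain ⟨W, hW, hWe⟩ := exists_symm_log hPD
  have hT := posDef_exp (hW.smul (1 / 2 : ℝ))
  have hTT := exp_half_mul_self W
  rw [hWe] at hTT
  set T := exp ((1 / 2 : ℝ) • W)
  have hS : ((formJ * bᵀ) * T * (b * formJ)).PosDef := by
    have := posDef_conj hT hm2
    rwa [← hmit, transpose_transpose, hmit] at this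
  set S := (formJ * bᵀ) * T * (b * formJ) with hSdef
  have hM : formJ * gram g * formJ = (formJ * a) * (aᵀ * formJ) := by
    simp only [gram, Matrix.mul_assoc]
    rfl
  have hSMS : S * (formJ * gram g * formJ) * S = gram g := by
    calc S * (formJ * gram g * formJ) * S
        = (formJ * bᵀ) * T * ((b * formJ) * (formJ * a)) * ((aᵀ * formJ) * (formJ * bᵀ)) * T *
          (b * formJ) := by rw [hM]; simp only [hSdef, Matrix.mul_assoc]
      _ = (formJ * bᵀ) * (T * T) * (b * formJ) := by
          rw [hm', hm1]; simp only [Matrix.mul_one, Matrix.mul_assoc]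
      _ = ((formJ * bᵀ) * (aᵀ * formJ)) * gram g * ((formJ * a) * (b * formJ)) := by
          rw [hTT]; simp only [Matrix.mul_assoc]
      _ = gram g := by rw [hm2, hm, Matrix.one_mul, Matrix.mul_one]
  -- uniqueness of positive solutions of `S M S = P`
  have huniq : ∀ S' : Matrix (Fin 3) (Fin 3) ℝ, S'.PosDef →
      S' * (formJ * gram g * formJ) * S' = gram g → S' = S := by
    intro S' hS' e
    have hcancel : ∀ R : Matrix (Fin 3) (Fin 3) ℝ,
        (formJ * bᵀ) * ((aᵀ * formJ) * R * (formJ * a)) * (b * formJ) = R := by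
      intro R
      calc _ = ((formJ * bᵀ) * (aᵀ * formJ)) * R * ((formJ * a) * (b * formJ)) := by
            simp only [Matrix.mul_assoc]
        _ = R := by rw [hm2, hm, Matrix.one_mul, Matrix.mul_one]
    have hsq : ∀ R : Matrix (Fin 3) (Fin 3) ℝ, R * (formJ * gram g * formJ) * R = gram g →
        ((aᵀ * formJ) * R * (formJ * a)) * ((aᵀ * formJ) * R * (formJ * a)) =
          (aᵀ * formJ) * gram g * (formJ * a) := by
      intro R hR
      rw [← hR, hM]
      simp only [Matrix.mul_assoc]
    have hpd : ∀ R : Matrix (Fin 3) (Fin 3) ℝ, R.PosDef →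
        ((aᵀ * formJ) * R * (formJ * a)).PosDef := by
      intro R hR
      have := posDef_conj hR hm1
      rwa [← hmt, transpose_transpose, hmt] at this
    have := posDef_mul_self_injective (hpd S' hS') (hpd S hS) ((hsq S' e).trans (hsq S hSMS).symm)
    rw [← hcancel S', this, hcancel S]
  obtain ⟨V, hV, hVS⟩ := exists_symm_log hS
  have hS1 : S * exp (-V) = 1 := by rw [← hVS]; exact mul_eq_one_comm.1 (exp_neg_mul_exp V)
  have hS2 : exp (-V) * S = 1 := mul_eq_one_comm.1 hS1
  -- The mirror image J S⁻¹ J solves the same equation, so uniqueness puts the midpoint S on Y.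
  have hmir : formJ * exp (-V) * formJ = S := by
    refine huniq _ ?_ ?_
    · have := posDef_conj (posDef_exp hV.neg) formJ_mul_self
      rwa [formJ_transpose] at this
    · have e1 : exp (-V) * gram g * exp (-V) = formJ * gram g * formJ := by
        rw [← hSMS]
        calc _ = (exp (-V) * S) * (formJ * gram g * formJ) * (S * exp (-V)) := by
              simp only [Matrix.mul_assoc]
          _ = _ := by rw [hS1, hS2, Matrix.one_mul, Matrix.mul_one, hSMS]
      calc _ = formJ * (exp (-V) * gram g * exp (-V)) * formJ := by
            simp only [Matrix.mul_assoc, formJ_mul_formJ_mul]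
        _ = gram g := by
            rw [e1]
            simp only [Matrix.mul_assoc, formJ_mul_self, Matrix.mul_one, formJ_mul_formJ_mul]
  have hSJS : S * formJ * S = formJ := by
    calc S * formJ * S = S * formJ * (formJ * exp (-V) * formJ) := by rw [hmir]
      _ = (S * exp (-V)) * formJ := by simp only [Matrix.mul_assoc, formJ_mul_formJ_mul]
      _ = formJ := by rw [hS1, Matrix.one_mul]
  obtain ⟨h, hh, hg⟩ := exists_mem_H_gram_eq hS hSJS
  exact ⟨h, hh, isFoot_of_gram hh (by rw [hg, hSMS])⟩

/-- The nearest point projection onto `Y`, with its description by perpendiculars. -/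
theorem exists_projection : ∃ π : X → X, IsNearestPointProjection π ∧
    (∀ g : G, ∃ h ∈ H, IsFoot g h ∧ π (QuotientGroup.mk g) = QuotientGroup.mk h) ∧
    (∀ g h : G, h ∈ H → IsFoot g h → π (QuotientGroup.mk g) = QuotientGroup.mk h) := by
  choose φ hφ hφf using exists_isFoot
  have hout : ∀ x : X, (QuotientGroup.mk (Quotient.out x) : X) = x := QuotientGroup.out_eq'
  have hnear : IsNearestPointProjection fun x => QuotientGroup.mk (φ (Quotient.out x)) := by
    intro x
    refine ⟨⟨_, hφ _, (smul_o _).symm⟩, fun y hy hne => ?_⟩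
    have := dX_lt_of_isFoot (hφ (Quotient.out x)) (hφf _) hy hne
    rwa [hout] at this
  have huniq : ∀ g h : G, h ∈ H → IsFoot g h →
      (QuotientGroup.mk (φ (Quotient.out (QuotientGroup.mk g : X))) : X) = QuotientGroup.mk h := by
    intro g h hh hf
    by_contra hne
    have h1 := dX_lt_of_isFoot hh hf (hnear (QuotientGroup.mk g)).1 hne
    have h2 := (hnear (QuotientGroup.mk g)).2 (QuotientGroup.mk h) ⟨h, hh, (smul_o h).symm⟩
      (Ne.symm hne)
    exact lt_asymm h1 h2
  exact ⟨_, hnear, fun g => ⟨φ g, hφ g, hφf g, huniq g _ (hφ g) (hφf g)⟩, huniq⟩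

/-! ### Trace bounds on Y and the diagonal elements -/

/-- A point of `Y` is at bounded distance from `o` if its matrix has bounded trace. -/
theorem dX_le_trace {g : G} (h : gram g * formJ * gram g = formJ) {T : ℝ}
    (hT : (gram g).trace ≤ T) :
    dX o (QuotientGroup.mk g) ≤ √(3 / 2) * √(2 * T) ∧
      dX (QuotientGroup.mk g) o ≤ √(3 / 2) * √(2 * T) := by
  obtain ⟨A, hA, hAe⟩ := exists_symm_log (posDef_gram g)
  have hJ := formJ_conj_log hA hAe h
  have hf : frob A ≤ √(2 * T) := by
    refine Real.le_sqrt_of_sq_le ((frob_sq_le_trace hA).trans ?_)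
    -- On Y the inverse of exp A is its conjugate by J, so both traces coincide; hence the factor 2
    -- in √(2T).
    rw [← hJ, exp_formJ_conj, trace_mul_comm (formJ * exp A), formJ_mul_formJ_mul, hAe]
    linarith
  have h2 : √(3 / 2) * frob A ≤ √(3 / 2) * √(2 * T) := by gcongr
  exact ⟨(dX_o_mk_le hA hAe).trans h2, (dX_mk_o_le hA hAe).trans h2⟩

theorem coe_aDiag (t : ℝ) : (aDiag t : Matrix (Fin 3) (Fin 3) ℝ) =
    diagonal ![Real.exp t, Real.exp (-2 * t), Real.exp t] := rfl

theorem coe_hDiag (s : ℝ) : (hDiag s : Matrix (Fin 3) (Fin 3) ℝ) =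
    diagonal ![Real.exp s, 1, Real.exp (-s)] := rfl

theorem hDiag_inv (s : ℝ) : (hDiag s)⁻¹ = hDiag (-s) := by
  rw [inv_eq_iff_mul_eq_one]
  refine Subtype.ext ?_
  rw [Matrix.SpecialLinearGroup.coe_mul, coe_hDiag, coe_hDiag, diagonal_mul_diagonal,
    Matrix.SpecialLinearGroup.coe_one, ← diagonal_one]
  congr 1
  funext i
  fin_cases i <;> simp [← Real.exp_add]

/-! ### Projection of a floating plane -/

section FloatingPlane

/-- The entry of `gram h` attached to the middle basis vector is the squared length of the
vector `h⁻¹ e₂`. -/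
theorem gram_one_one {h : G} (hh : h ∈ H) :
    gram h 1 1 = ((h⁻¹ : G) : Matrix (Fin 3) (Fin 3) ℝ) 0 1 ^ 2 +
      ((h⁻¹ : G) : Matrix (Fin 3) (Fin 3) ℝ) 1 1 ^ 2 +
      ((h⁻¹ : G) : Matrix (Fin 3) (Fin 3) ℝ) 2 1 ^ 2 := by
  have e := inv_mul_formJ hh
  generalize ((h⁻¹ : G) : Matrix (Fin 3) (Fin 3) ℝ) = b at e ⊢
  have e0 := congrFun (congrFun e 0) 1
  have e1 := congrFun (congrFun e 1) 1
  have e2 := congrFun (congrFun e 2) 1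
  simp [formJ, mul_apply, Fin.sum_univ_three] at e0 e1 e2
  simp only [gram, mul_apply, Fin.sum_univ_three, transpose_apply, ← e0, ← e1, ← e2]
  ring

theorem inv_col_one {h : G} (hh : h ∈ H) :
    2 * ((h⁻¹ : G) : Matrix (Fin 3) (Fin 3) ℝ) 0 1 * ((h⁻¹ : G) : Matrix (Fin 3) (Fin 3) ℝ) 2 1 -
      ((h⁻¹ : G) : Matrix (Fin 3) (Fin 3) ℝ) 1 1 ^ 2 = -1 := by
  have e := congrFun (congrFun (transpose_mul_formJ_mul (H.inv_mem hh)) 1) 1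
  generalize ((h⁻¹ : G) : Matrix (Fin 3) (Fin 3) ℝ) = b at e ⊢
  simp [formJ, mul_apply, Fin.sum_univ_three] at e
  linarith

/-- Since k J kᵀ = J, the element k drops out: the form depends only on the floating plane. Here a_t
J a_t differs from e^{2t} J only in the middle entry, which gives the rank one term. -/
theorem floating_form_apply {h k : G} (hh : h ∈ H) (hk : k ∈ H) (t : ℝ) (i j : Fin 3) :
    (((h⁻¹ * (aDiag t * k) : G) : Matrix (Fin 3) (Fin 3) ℝ) * formJ *
      ((h⁻¹ * (aDiag t * k) : G) : Matrix (Fin 3) (Fin 3) ℝ)ᵀ) i j =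
    Real.exp (2 * t) * formJ i j + (Real.exp (2 * t) - Real.exp (-4 * t)) *
      (((h⁻¹ : G) : Matrix (Fin 3) (Fin 3) ℝ) i 1 * ((h⁻¹ : G) : Matrix (Fin 3) (Fin 3) ℝ) j 1) := by
  have e1 : (aDiag t : Matrix (Fin 3) (Fin 3) ℝ) * formJ * (aDiag t : Matrix (Fin 3) (Fin 3) ℝ)ᵀ =
      Real.exp (2 * t) • formJ + (Real.exp (2 * t) - Real.exp (-4 * t)) •
        vecMulVec (Pi.single 1 1) (Pi.single 1 1) := by
    have x1 : Real.exp t * Real.exp t = Real.exp (2 * t) := by rw [← Real.exp_add]; ring_nf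
    have x2 : Real.exp (-(2 * t)) * Real.exp (-(2 * t)) = Real.exp (-(4 * t)) := by
      rw [← Real.exp_add]; ring_nf
    rw [coe_aDiag, diagonal_transpose]
    ext i j
    rw [mul_diagonal, diagonal_mul]
    fin_cases i <;> fin_cases j <;> simp [formJ, vecMulVec, ← x1, ← x2]
    ring
  have e2 : (((h⁻¹ * (aDiag t * k) : G) : Matrix (Fin 3) (Fin 3) ℝ) * formJ *
      ((h⁻¹ * (aDiag t * k) : G) : Matrix (Fin 3) (Fin 3) ℝ)ᵀ) = Real.exp (2 * t) • formJ +
      (Real.exp (2 * t) - Real.exp (-4 * t)) • (((h⁻¹ : G) : Matrix (Fin 3) (Fin 3) ℝ) *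
        vecMulVec (Pi.single 1 1) (Pi.single 1 1) *
        ((h⁻¹ : G) : Matrix (Fin 3) (Fin 3) ℝ)ᵀ) := by
    calc _ = ((h⁻¹ : G) : Matrix (Fin 3) (Fin 3) ℝ) * ((aDiag t : Matrix (Fin 3) (Fin 3) ℝ) *
          ((k : Matrix (Fin 3) (Fin 3) ℝ) * formJ * (k : Matrix (Fin 3) (Fin 3) ℝ)ᵀ) *
          (aDiag t : Matrix (Fin 3) (Fin 3) ℝ)ᵀ) * ((h⁻¹ : G) : Matrix (Fin 3) (Fin 3) ℝ)ᵀ := by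
          simp only [Matrix.SpecialLinearGroup.coe_mul, transpose_mul, Matrix.mul_assoc]
      _ = _ := by
          rw [mul_formJ_mul_transpose hk, e1, Matrix.mul_add, Matrix.add_mul, Matrix.mul_smul,
            Matrix.smul_mul, mul_formJ_mul_transpose (H.inv_mem hh), Matrix.mul_smul,
            Matrix.smul_mul]
  rw [e2]
  generalize ((h⁻¹ : G) : Matrix (Fin 3) (Fin 3) ℝ) = b
  simp [mul_apply, vecMulVec, Fin.sum_univ_three]

/-- If `h o` is the foot of a point of the floating plane at height `t`, then the two eigenspaces
of `J` are orthogonal for its matrix; `s` is the component of `h⁻¹ e₂` in the first one. -/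
theorem foot_pairing {h k : G} (hh : h ∈ H) (hk : k ∈ H) {t : ℝ}
    (hf : formJ * gram (h⁻¹ * (aDiag t * k)) * formJ = gram (h⁻¹ * (aDiag t * k))) {s : ℝ}
    (hs : s = (((h⁻¹ : G) : Matrix (Fin 3) (Fin 3) ℝ) 0 1 +
      ((h⁻¹ : G) : Matrix (Fin 3) (Fin 3) ℝ) 2 1) / 2) :
    ∃ d m : ℝ, 0 < d ∧ 0 < m ∧ (Real.exp (2 * t) - Real.exp (-4 * t)) * s *
      ((Real.exp (2 * t) + 2 * (Real.exp (2 * t) - Real.exp (-4 * t)) * s ^ 2) *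
        (1 + 2 * s ^ 2) * d + 2 * ((Real.exp (2 * t) - Real.exp (-4 * t)) *
        (1 + 2 * s ^ 2) - Real.exp (2 * t)) * m) = 0 := by
  have hN := floating_form_apply hh hk t
  have hcol := inv_col_one hh
  set n : Fin 3 → ℝ := fun i => ((h⁻¹ : G) : Matrix (Fin 3) (Fin 3) ℝ) i 1 with hn
  set E := Real.exp (2 * t)
  set κ := E - Real.exp (-4 * t)
  set g := h⁻¹ * (aDiag t * k)
  set N : Matrix (Fin 3) (Fin 3) ℝ :=
    (g : Matrix (Fin 3) (Fin 3) ℝ) * formJ * (g : Matrix (Fin 3) (Fin 3) ℝ)ᵀ with hNdef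
  have hcol' : 2 * n 0 * n 2 - n 1 ^ 2 = -1 := hcol
  have hs' : s = (n 0 + n 2) / 2 := hs
  set D : Matrix (Fin 3) (Fin 3) ℝ :=
    ((g⁻¹ : G) : Matrix (Fin 3) (Fin 3) ℝ)ᵀ * ((g⁻¹ : G) : Matrix (Fin 3) (Fin 3) ℝ) with hD
  have hDQ : D * gram g = 1 := gram_inv_transpose g
  have hQD : gram g * D = 1 := mul_eq_one_comm.1 hDQ
  have hDpos : D.PosDef := by
    have := (posDef_gram g).inv
    rwa [inv_eq_left_inv hDQ] at this
  have hDJ : formJ * D * formJ = D := by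
    refine left_inv_eq_right_inv (a := gram g) ?_ hQD
    conv_lhs => rw [← hf]
    calc _ = formJ * (D * gram g) * formJ := by simp only [Matrix.mul_assoc, formJ_mul_formJ_mul]
      _ = 1 := by rw [hDQ, Matrix.mul_one, formJ_mul_self]
  -- N = g J gᵀ intertwines the point with its inverse. It links the J-invariant matrices D and
  -- `gram g` through data depending only on h and t.
  have hNDN : N * D * N = gram g := by
    calc N * D * N = (g : Matrix (Fin 3) (Fin 3) ℝ) * formJ *
        ((g : Matrix (Fin 3) (Fin 3) ℝ)ᵀ * ((g⁻¹ : G) : Matrix (Fin 3) (Fin 3) ℝ)ᵀ) *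
        (((g⁻¹ : G) : Matrix (Fin 3) (Fin 3) ℝ) * (g : Matrix (Fin 3) (Fin 3) ℝ)) * formJ *
        (g : Matrix (Fin 3) (Fin 3) ℝ)ᵀ := by simp only [hNdef, hD, Matrix.mul_assoc]
      _ = gram g := by
        rw [coe_transpose_mul_inv_transpose, coe_inv_mul_coe, Matrix.mul_one, Matrix.mul_one,
          Matrix.mul_assoc _ formJ formJ, formJ_mul_self, Matrix.mul_one, gram]
  have hNs : Nᵀ = N := by
    simp [hNdef, transpose_mul, formJ_transpose, Matrix.mul_assoc]
  -- f spans the +1 eigenspace of J and β is the component of n in the -1 eigenspace: n = s f + β.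
  -- As F(n) = -1, |β|² = 1 + 2s².
  set f : Fin 3 → ℝ := ![1, 0, 1] with hfdef
  set β : Fin 3 → ℝ := ![(n 0 - n 2) / 2, n 1, (n 2 - n 0) / 2] with hβ
  have hJf : formJ *ᵥ f = f := by
    ext i; fin_cases i <;> simp [formJ, hfdef, mulVec, dotProduct, Fin.sum_univ_three]
  have hJβ : formJ *ᵥ β = -β := by
    ext i; fin_cases i <;> simp [formJ, hβ, mulVec, dotProduct, Fin.sum_univ_three] <;> ring
  -- the eigenspaces of `J` are orthogonal for matrices commuting with `J`
  have horth : ∀ R : Matrix (Fin 3) (Fin 3) ℝ, formJ * R * formJ = R → f ⬝ᵥ R *ᵥ β = 0 := by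
    intro R hR
    have : f ⬝ᵥ R *ᵥ β = -(f ⬝ᵥ R *ᵥ β) := by
      conv_lhs => rw [← hR, ← mulVec_mulVec, ← mulVec_mulVec, hJβ, dotProduct_mulVec,
        ← mulVec_transpose, formJ_transpose, hJf, mulVec_neg, dotProduct_neg]
    linarith
  have hfD := horth D hDJ
  have hDf : β ⬝ᵥ D *ᵥ f = 0 := by
    rw [dotProduct_comm, ← hfD, dotProduct_mulVec, ← mulVec_transpose]
    congr 2
    simp [hD, transpose_mul]
  have hQ := horth (gram g) hf
  have hb : 1 + 2 * s ^ 2 = β ⬝ᵥ β := by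
    simp only [hβ, dotProduct, Fin.sum_univ_three, Matrix.cons_val, hs']
    linear_combination hcol'
  have hNf : N *ᵥ f = (E + 2 * κ * s ^ 2) • f + (2 * κ * s) • β := by
    ext i
    simp only [mulVec, dotProduct, Fin.sum_univ_three, hN]
    fin_cases i <;>
      simp [formJ, hfdef, hβ, hs', hn] <;> ring
  have hNβ : N *ᵥ β = (κ * (1 + 2 * s ^ 2) * s) • f + (κ * (1 + 2 * s ^ 2) - E) • β := by
    rw [hb]
    ext i
    simp only [mulVec, dotProduct, Fin.sum_univ_three, hN]
    fin_cases i <;>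
      simp [formJ, hfdef, hβ, hs', hn] <;> ring
  have hf0 : f ≠ 0 := fun e => by simpa [hfdef] using congrFun e 0
  have hβ0 : β ≠ 0 := fun e => by
    rw [e, dotProduct_zero] at hb
    nlinarith [sq_nonneg s]
  refine ⟨f ⬝ᵥ D *ᵥ f, β ⬝ᵥ D *ᵥ β, by simpa using hDpos.dotProduct_mulVec_pos hf0,
    by simpa using hDpos.dotProduct_mulVec_pos hβ0, ?_⟩
  -- Orthogonality of f and β for `gram g` reads (Nf)·D(Nβ) = 0. The mixed terms vanish because f
  -- and β are also orthogonal for D.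
  rw [← hNDN, ← mulVec_mulVec, ← mulVec_mulVec, dotProduct_mulVec, ← mulVec_transpose, hNs, hNf,
    hNβ] at hQ
  simp only [mulVec_add, mulVec_smul, add_dotProduct, dotProduct_add, smul_dotProduct,
    dotProduct_smul, hfD, hDf, smul_eq_mul] at hQ
  linear_combination hQ

/-- Unless s = 0, the two terms of the pairing equation, weighted by d, m > 0, must have opposite
signs. For either sign of t this gives 2s²(e^{6|t|} - 1) < 1, while |n|² = 1 + 4s². -/
theorem foot_bound {h k : G} (hh : h ∈ H) (hk : k ∈ H) {t ε : ℝ} (hε : 0 < ε) (ht : ε < |t|)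
    (hf : formJ * gram (h⁻¹ * (aDiag t * k)) * formJ = gram (h⁻¹ * (aDiag t * k))) :
    gram h 1 1 ≤ 1 + 2 / (Real.exp (6 * ε) - 1) := by
  obtain ⟨d, m, hd, hm, e⟩ := foot_pairing hh hk hf rfl
  have hcol := inv_col_one hh
  rw [gram_one_one hh]
  set n0 := ((h⁻¹ : G) : Matrix (Fin 3) (Fin 3) ℝ) 0 1
  set n1 := ((h⁻¹ : G) : Matrix (Fin 3) (Fin 3) ℝ) 1 1
  set n2 := ((h⁻¹ : G) : Matrix (Fin 3) (Fin 3) ℝ) 2 1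
  set s := (n0 + n2) / 2 with hs
  have hc : 0 < Real.exp (6 * ε) - 1 := by
    have := Real.one_lt_exp_iff.2 (by linarith : 0 < 6 * ε)
    linarith
  have hred : n0 ^ 2 + n1 ^ 2 + n2 ^ 2 = 1 + 4 * s ^ 2 := by
    rw [hs]; linear_combination -hcol
  suffices h2 : 2 * s ^ 2 * (Real.exp (6 * ε) - 1) ≤ 1 by
    rw [hred, add_le_add_iff_left, le_div_iff₀ hc]
    linarith
  rcases eq_or_ne s 0 with hs0 | hs0
  · rw [hs0]; simp
  have hE : 0 < Real.exp (2 * t) := Real.exp_pos _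
  have hW : 0 < Real.exp (-4 * t) := Real.exp_pos _
  have hs2 : 0 < s ^ 2 := by positivity
  -- For t > 0 the d-term is positive, so the m-term must be negative. For t < 0 the m-term is
  -- negative, so the d-term must be positive.
  rcases lt_abs.1 ht with h0 | h0
  · have hr : Real.exp (-4 * t) * Real.exp (6 * t) = Real.exp (2 * t) := by
      rw [← Real.exp_add]; ring_nf
    have hmono : Real.exp (6 * ε) < Real.exp (6 * t) := Real.exp_lt_exp.2 (by linarith)
    set W := Real.exp (-4 * t)
    set E := Real.exp (2 * t)
    have hκ : 0 < E - W := by nlinarith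
    have e' := (mul_eq_zero.1 e).resolve_left (by positivity)
    have h3 : 0 < (E + 2 * (E - W) * s ^ 2) * (1 + 2 * s ^ 2) * d := by positivity
    have h4 : (E - W) * (1 + 2 * s ^ 2) - E < 0 := by
      by_contra hcon
      nlinarith [mul_nonneg (not_lt.1 hcon) hm.le]
    have h5 : W * (2 * s ^ 2 * (Real.exp (6 * t) - 1)) < W * 1 := by
      nlinarith
    have h6 := lt_of_mul_lt_mul_left h5 hW.le
    nlinarith
  · have hr : Real.exp (2 * t) * Real.exp (6 * (-t)) = Real.exp (-4 * t) := by
      rw [← Real.exp_add]; ring_nf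
    have hmono : Real.exp (6 * ε) < Real.exp (6 * (-t)) := Real.exp_lt_exp.2 (by linarith)
    set W := Real.exp (-4 * t)
    set E := Real.exp (2 * t)
    have hκ : E - W < 0 := by nlinarith
    have e' := (mul_eq_zero.1 e).resolve_left (mul_ne_zero hκ.ne hs0)
    have h4 : (E - W) * (1 + 2 * s ^ 2) - E < 0 := by nlinarith
    have h3 : 0 < E + 2 * (E - W) * s ^ 2 := by
      by_contra hcon
      have x1 : (E + 2 * (E - W) * s ^ 2) * ((1 + 2 * s ^ 2) * d) ≤ 0 :=
        mul_nonpos_of_nonpos_of_nonneg (not_lt.1 hcon) (by positivity)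
      nlinarith [mul_neg_of_neg_of_pos h4 hm]
    have h5 : E * (2 * s ^ 2 * (Real.exp (6 * (-t)) - 1)) < E * 1 := by
      nlinarith
    have h6 := lt_of_mul_lt_mul_left h5 hE.le
    nlinarith

/-- A point `h o` of `Y` is close to `A₀ o` if the middle entry of `gram h` is bounded. -/
theorem exists_hDiag_close {h : G} (hh : h ∈ H) {y : ℝ} (hy : gram h 1 1 ≤ y) :
    ∃ s : ℝ, dX (QuotientGroup.mk ((hDiag s)⁻¹ * h)) o ≤ √(3 / 2) * √(2 * (2 + 3 * y)) := by
  have hJ := gram_mul_formJ_mul_gram hh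
  have hpos := fun i => (posDef_gram h).diag_pos (i := i)
  have hsymm := (gram_isSymm h).apply
  set S := gram h
  have h0 : 0 < S 0 0 := hpos 0
  have h1 : 0 < S 1 1 := hpos 1
  have h2 : 0 < S 2 2 := hpos 2
  -- Translation by h_s⁻¹ multiplies S₀₀ by e^{-2s} and S₂₂ by e^{2s}; this s makes them equal, both
  -- to √(S₀₀S₂₂).
  refine ⟨Real.log (S 0 0 / S 2 2) / 4, ?_⟩
  set s := Real.log (S 0 0 / S 2 2) / 4 with hs
  have hu : Real.exp (2 * s) ^ 2 * S 2 2 = S 0 0 := by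
    rw [← Real.exp_nat_mul, hs, show ((2 : ℕ) : ℝ) * (2 * (Real.log (S 0 0 / S 2 2) / 4)) =
      Real.log (S 0 0 / S 2 2) by push_cast; ring, Real.exp_log (by positivity)]
    field_simp
  have hg : gram ((hDiag s)⁻¹ * h) = diagonal ![Real.exp (-s), 1, Real.exp s] * S *
      diagonal ![Real.exp (-s), 1, Real.exp s] := by
    rw [gram_mul, hDiag_inv, coe_hDiag, diagonal_transpose, neg_neg]
  have hδ : diagonal ![Real.exp (-s), 1, Real.exp s] * formJ *
      diagonal ![Real.exp (-s), 1, Real.exp s] = formJ := by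
    ext i j
    rw [mul_diagonal, diagonal_mul]
    fin_cases i <;> fin_cases j <;> simp [formJ, ← Real.exp_add]
  refine (dX_le_trace ?_ ?_).2
  · rw [hg]
    set δ := diagonal ![Real.exp (-s), 1, Real.exp s]
    calc _ = δ * (S * (δ * formJ * δ) * S) * δ := by simp only [Matrix.mul_assoc]
      _ = formJ := by rw [hδ, hJ, hδ]
  · have e02 := congrFun (congrFun hJ 0) 2
    have e11 := congrFun (congrFun hJ 1) 1
    simp [formJ, mul_apply, Fin.sum_univ_three] at e02 e11
    rw [hsymm 0 1, hsymm 1 2] at e11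
    have hx : Real.exp (-s) * Real.exp (-s) * Real.exp (2 * s) = 1 := by
      rw [← Real.exp_add, ← Real.exp_add, ← Real.exp_zero]; ring_nf
    have hx2 : Real.exp s * Real.exp s = Real.exp (2 * s) := by
      rw [← Real.exp_add]; ring_nf
    have htr : (gram ((hDiag s)⁻¹ * h)).trace = S 1 1 + 2 * (Real.exp (2 * s) * S 2 2) := by
      rw [hg, trace, Fin.sum_univ_three]
      simp only [diag_apply, mul_diagonal, diagonal_mul, Matrix.cons_val]
      rw [← hu]
      linear_combination (Real.exp (2 * s) * S 2 2) * hx + S 2 2 * hx2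
    have hp : 0 < Real.exp (2 * s) * S 2 2 := by positivity
    -- Two entries of S J S = J give S₀₀S₂₂ + S₀₂² = (1 + S₁₁²)/2. So the trace is at most S₁₁ + 2(1
    -- + S₁₁), which is the 2 + 3y of the statement.
    have hsq : (Real.exp (2 * s) * S 2 2) ^ 2 ≤ (1 + S 1 1) ^ 2 := by
      have : (Real.exp (2 * s) * S 2 2) ^ 2 = S 0 0 * S 2 2 := by rw [← hu]; ring
      rw [this]
      nlinarith [sq_nonneg (S 0 2)]
    have hle := (sq_le_sq₀ hp.le (by linarith)).1 hsq
    rw [htr]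
    linarith

end FloatingPlane

/-! ### Projection of the points γ_t(s) -/

section Gamma

/-- The matrix of the point `k₀ h_s o`. -/
theorem gram_k₀_hDiag (s : ℝ) : gram (k₀ * hDiag s) =
    !![(1 + Real.cosh (2 * s)) / 2, -(Real.sinh (2 * s) / √2), (Real.cosh (2 * s) - 1) / 2;
      -(Real.sinh (2 * s) / √2), Real.cosh (2 * s), -(Real.sinh (2 * s) / √2);
      (Real.cosh (2 * s) - 1) / 2, -(Real.sinh (2 * s) / √2), (1 + Real.cosh (2 * s)) / 2] := by
  have hq : (√2)⁻¹ * (√2)⁻¹ = (1 / 2 : ℝ) := by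
    rw [← mul_inv, Real.mul_self_sqrt (by norm_num)]; norm_num
  have hc : Real.cosh (2 * s) = (Real.exp s * Real.exp s + Real.exp (-s) * Real.exp (-s)) / 2 := by
    rw [Real.cosh_eq, ← Real.exp_add, ← Real.exp_add]; ring_nf
  have hs : Real.sinh (2 * s) = (Real.exp s * Real.exp s - Real.exp (-s) * Real.exp (-s)) / 2 := by
    rw [Real.sinh_eq, ← Real.exp_add, ← Real.exp_add]; ring_nf
  have hk : (k₀ : Matrix (Fin 3) (Fin 3) ℝ) = !![1 / 2, 1 / √2, 1 / 2;
      -(1 / √2), 0, 1 / √2; 1 / 2, -(1 / √2), 1 / 2] := rfl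
  rw [gram, Matrix.SpecialLinearGroup.coe_mul, hk, coe_hDiag, hc, hs]
  set a := Real.exp s
  set b := Real.exp (-s)
  simp only [one_div, div_eq_mul_inv _ (√2)]
  set q := (√2)⁻¹
  ext i j
  rw [mul_apply, Fin.sum_univ_three]
  simp only [transpose_apply, mul_diagonal]
  fin_cases i <;> fin_cases j <;> simp
  · linear_combination hq
  · ring
  · linear_combination -hq
  · ring
  · linear_combination (a * a + b * b) * hq
  · ring
  · linear_combination -hq
  · ring
  · linear_combination hq

theorem gram_k₀_hDiag_mem (s : ℝ) :
    gram (k₀ * hDiag s) * formJ * gram (k₀ * hDiag s) = formJ := by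
  have hA : Real.cosh (2 * s) ^ 2 = 1 + 2 * (Real.sinh (2 * s) / √2) ^ 2 := by
    rw [div_pow, Real.sq_sqrt (by norm_num), Real.cosh_sq]; ring
  rw [gram_k₀_hDiag]
  set A := Real.cosh (2 * s)
  set β := Real.sinh (2 * s) / √2
  ext i j
  fin_cases i <;> fin_cases j <;>
    simp [formJ, mul_apply, Fin.sum_univ_three]
  · linear_combination hA / 2
  · ring
  · linear_combination hA / 2
  · ring
  · linear_combination -hA
  · ring
  · linear_combination hA / 2
  · ring
  · linear_combination hA / 2

/-- The foot of `γ_t(s)` is `k₀ h_r o` where `tanh 2r = tanh 2s / cosh 3t`. -/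
theorem gram_foot_γ {t s r : ℝ}
    (hr : Real.sinh (2 * r) * (Real.cosh (2 * s) * Real.cosh (3 * t)) =
      Real.cosh (2 * r) * Real.sinh (2 * s)) :
    gram (k₀ * hDiag r) * (formJ * gram (aDiag t * (k₀ * hDiag s)) * formJ) *
      gram (k₀ * hDiag r) = gram (aDiag t * (k₀ * hDiag s)) := by
  have hA : Real.cosh (2 * r) ^ 2 = 1 + 2 * (Real.sinh (2 * r) / √2) ^ 2 := by
    rw [div_pow, Real.sq_sqrt (by norm_num), Real.cosh_sq]; ring
  have hrel : Real.sinh (2 * r) / √2 * Real.cosh (2 * s) *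
      (Real.exp t ^ 2 + Real.exp (-2 * t) ^ 2) =
      2 * Real.cosh (2 * r) * Real.exp t * Real.exp (-2 * t) * (Real.sinh (2 * s) / √2) := by
    -- The ratio of the two eigenvalues of a_t is e^{3t}; this is the origin of cosh 3t.
    have e : Real.exp t ^ 2 + Real.exp (-2 * t) ^ 2 =
        2 * (Real.exp t * Real.exp (-2 * t)) * Real.cosh (3 * t) := by
      have e1 : Real.exp t ^ 2 = Real.exp t * Real.exp (-2 * t) * Real.exp (3 * t) := by
        rw [sq, ← Real.exp_add, ← Real.exp_add, ← Real.exp_add]; ring_nf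
      have e2 : Real.exp (-2 * t) ^ 2 = Real.exp t * Real.exp (-2 * t) * Real.exp (-(3 * t)) := by
        rw [sq, ← Real.exp_add, ← Real.exp_add, ← Real.exp_add]; ring_nf
      rw [Real.cosh_eq, e1, e2]
      ring
    rw [e]
    linear_combination (2 * (Real.exp t * Real.exp (-2 * t)) / √2) * hr
  rw [gram_mul (aDiag t), coe_aDiag, gram_k₀_hDiag, gram_k₀_hDiag, diagonal_transpose]
  generalize Real.cosh (2 * r) = A at hA hrel ⊢
  generalize Real.sinh (2 * r) / √2 = β at hA hrel ⊢
  generalize Real.cosh (2 * s) = C at hrel ⊢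
  generalize Real.sinh (2 * s) / √2 = σ at hrel ⊢
  generalize Real.exp t = u at hrel ⊢
  generalize Real.exp (-2 * t) = w at hrel ⊢
  have hP : diagonal ![u, w, u] * !![(1 + C) / 2, -σ, (C - 1) / 2; -σ, C, -σ;
      (C - 1) / 2, -σ, (1 + C) / 2] * diagonal ![u, w, u] =
      !![u * ((1 + C) / 2) * u, -(u * σ * w), u * ((C - 1) / 2) * u;
        -(w * σ * u), w * C * w, -(w * σ * u);
        u * ((C - 1) / 2) * u, -(u * σ * w), u * ((1 + C) / 2) * u] := by
    ext i j
    rw [mul_diagonal, diagonal_mul]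
    fin_cases i <;> fin_cases j <;> simp
  have hM : formJ * !![u * ((1 + C) / 2) * u, -(u * σ * w), u * ((C - 1) / 2) * u;
        -(w * σ * u), w * C * w, -(w * σ * u);
        u * ((C - 1) / 2) * u, -(u * σ * w), u * ((1 + C) / 2) * u] * formJ =
      !![u * ((1 + C) / 2) * u, u * σ * w, u * ((C - 1) / 2) * u;
        w * σ * u, w * C * w, w * σ * u;
        u * ((C - 1) / 2) * u, u * σ * w, u * ((1 + C) / 2) * u] := by
    ext i j
    fin_cases i <;> fin_cases j <;> simp [formJ, mul_apply, Fin.sum_univ_three]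
  rw [hP, hM]
  ext i j
  fin_cases i <;> fin_cases j <;>
    simp [mul_apply, Fin.sum_univ_three]
  · linear_combination u ^ 2 * C / 2 * hA + β * hrel
  · linear_combination -A * hrel - u * w * σ * hA
  · linear_combination u ^ 2 * C / 2 * hA + β * hrel
  · linear_combination -A * hrel - u * w * σ * hA
  · linear_combination w ^ 2 * C * hA + 2 * β * hrel
  · linear_combination -A * hrel - u * w * σ * hA
  · linear_combination u ^ 2 * C / 2 * hA + β * hrel
  · linear_combination -A * hrel - u * w * σ * hA
  · linear_combination u ^ 2 * C / 2 * hA + β * hrel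

theorem exists_foot_parameter (t s : ℝ) : ∃ r : ℝ,
    Real.sinh (2 * r) * (Real.cosh (2 * s) * Real.cosh (3 * t)) =
      Real.cosh (2 * r) * Real.sinh (2 * s) := by
  have hC := Real.cosh_sq (2 * s)
  have h1 := Real.one_le_cosh (3 * t)
  have hX : 0 < Real.cosh (2 * s) * Real.cosh (3 * t) :=
    mul_pos (Real.cosh_pos _) (Real.cosh_pos _)
  have hXZ : 0 < (Real.cosh (2 * s) * Real.cosh (3 * t)) ^ 2 - Real.sinh (2 * s) ^ 2 := by
    have : Real.cosh (2 * s) ^ 2 * 1 ≤ Real.cosh (2 * s) ^ 2 * Real.cosh (3 * t) ^ 2 := by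
      gcongr
      exact one_le_pow₀ h1
    rw [mul_pow]
    linarith
  set X := Real.cosh (2 * s) * Real.cosh (3 * t)
  set Z := Real.sinh (2 * s)
  have hv : 0 < √(X ^ 2 - Z ^ 2) := Real.sqrt_pos.2 hXZ
  have hv2 : √(X ^ 2 - Z ^ 2) ^ 2 = X ^ 2 - Z ^ 2 := Real.sq_sqrt hXZ.le
  -- Solves tanh 2r = Z/X, which is possible because |Z| < X.
  refine ⟨Real.arsinh (Z / √(X ^ 2 - Z ^ 2)) / 2, ?_⟩
  rw [mul_div_cancel₀ _ two_ne_zero, Real.sinh_arsinh, Real.cosh_arsinh]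
  have : 1 + (Z / √(X ^ 2 - Z ^ 2)) ^ 2 = (X / √(X ^ 2 - Z ^ 2)) ^ 2 := by
    rw [div_pow, div_pow, hv2, eq_div_iff hXZ.ne', add_mul, div_mul_cancel₀ _ hXZ.ne']
    ring
  rw [this, Real.sqrt_sq (by positivity)]
  ring

/-- The hypotheses give tanh² 2r ≤ θ, hence cosh² 2r ≤ 1/(1 - θ); and cosh ≤ cosh². -/
theorem cosh_foot_le {t s r θ : ℝ} (hθ : θ < 1)
    (hr : Real.sinh (2 * r) * (Real.cosh (2 * s) * Real.cosh (3 * t)) =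
      Real.cosh (2 * r) * Real.sinh (2 * s))
    (h : Real.sinh (2 * s) ^ 2 ≤ θ * (Real.cosh (2 * s) * Real.cosh (3 * t)) ^ 2) :
    Real.cosh (2 * r) ≤ 1 / (1 - θ) := by
  have hX : 0 < (Real.cosh (2 * s) * Real.cosh (3 * t)) ^ 2 := by
    have := Real.cosh_pos (2 * s)
    have := Real.cosh_pos (3 * t)
    positivity
  have h1 : Real.sinh (2 * r) ^ 2 ≤ θ * Real.cosh (2 * r) ^ 2 := by
    refine le_of_mul_le_mul_right ?_ hX
    rw [← mul_pow, hr, mul_pow]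
    calc _ ≤ Real.cosh (2 * r) ^ 2 * (θ * (Real.cosh (2 * s) * Real.cosh (3 * t)) ^ 2) := by
          gcongr
      _ = _ := by ring
  have h2 := Real.cosh_sq (2 * r)
  have h3 := Real.one_le_cosh (2 * r)
  rw [le_div_iff₀ (by linarith)]
  nlinarith

end Gamma

/-! ### Uniform bounds and conclusion -/

/-- The projection of a floating plane stays close to its geodesic. -/
theorem foot_close_to_geodesic {h₀ h k : G} (hh₀ : h₀ ∈ H) (hh : h ∈ H) (hk : k ∈ H) {t ε : ℝ}
    (hε : 0 < ε) (ht : ε < |t|) (hf : IsFoot (h₀ * (aDiag t * k)) h) :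
    ∃ q ∈ geodesic h₀, dX (QuotientGroup.mk h) q ≤
      √(3 / 2) * √(2 * (2 + 3 * (1 + 2 / (Real.exp (6 * ε) - 1)))) := by
  have hm : h₀⁻¹ * h ∈ H := H.mul_mem (H.inv_mem hh₀) hh
  have e : h⁻¹ * (h₀ * (aDiag t * k)) = (h₀⁻¹ * h)⁻¹ * (aDiag t * k) := by group
  rw [IsFoot, e] at hf
  obtain ⟨s, hs⟩ := exists_hDiag_close hm (foot_bound hm hk hε ht hf)
  refine ⟨h₀ • hDiag s • o, ⟨s, rfl⟩, ?_⟩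
  rw [← dX_smul_smul h₀⁻¹, inv_smul_smul, ← dX_smul_smul (hDiag s)⁻¹, inv_smul_smul, smul_mk,
    smul_mk]
  exact hs

/-- A bound for the projections of the points `γ_t(s)`. -/
theorem dX_foot_γ_le {π : X → X}
    (hπ : ∀ g h : G, h ∈ H → IsFoot g h → π (QuotientGroup.mk g) = QuotientGroup.mk h)
    {t s θ : ℝ} (hθ : θ < 1)
    (h : Real.sinh (2 * s) ^ 2 ≤ θ * (Real.cosh (2 * s) * Real.cosh (3 * t)) ^ 2) :
    dX o (π (γ t s)) ≤ √(3 / 2) * √(2 * (1 + 2 * (1 / (1 - θ)))) := by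
  obtain ⟨r, hr⟩ := exists_foot_parameter t s
  -- An element p of `H` representing the same point replaces k₀ h_r, so membership of k₀ h_r in the
  -- identity component need not be checked.
  obtain ⟨p, hp, hpg⟩ := exists_mem_H_gram_eq (posDef_gram (k₀ * hDiag r)) (gram_k₀_hDiag_mem r)
  have hγ : γ t s = QuotientGroup.mk (aDiag t * (k₀ * hDiag s)) := by
    rw [γ, smul_o, smul_mk, smul_mk]
  rw [hγ, hπ _ p hp (isFoot_of_gram hp (by rw [hpg, gram_foot_γ hr]))]
  refine (dX_le_trace (gram_mul_formJ_mul_gram hp) ?_).1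
  have hc := cosh_foot_le hθ hr h
  rw [hpg, gram_k₀_hDiag, trace_fin_three_of]
  linarith

end FloatingPlanes

open FloatingPlanes

theorem mainTheorem5 :
    ∃ π : FloatingPlanes.X → FloatingPlanes.X,
      FloatingPlanes.IsNearestPointProjection π ∧
      -- for every geodesic `L = h A₀ o` of `Y`, the union of the `π(Y_{L,t})`, `|t| > ε`,
      -- lies within a bounded distance from `L`
      (∀ h ∈ FloatingPlanes.H, ∀ ε : ℝ, 0 < ε → ∃ R : ℝ,
        ∀ p ∈ ⋃ t ∈ {t : ℝ | ε < |t|}, π '' FloatingPlanes.floatingPlane h t,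
          ∃ q ∈ FloatingPlanes.geodesic h, FloatingPlanes.dX p q ≤ R) ∧
      -- if `t_n` is bounded (and `|t_n| > ε`), then `π(γ_{t_n}(s_n))` is bounded
      (∀ ε : ℝ, 0 < ε → ∀ t s : ℕ → ℝ, (∀ n, ε < |t n|) → (∃ C : ℝ, ∀ n, |t n| ≤ C) →
        ∃ R : ℝ, ∀ n,
          FloatingPlanes.dX FloatingPlanes.o (π (FloatingPlanes.γ (t n) (s n))) ≤ R) ∧
      -- if `|s_n|` is bounded, then `π(γ_{t_n}(s_n))` is bounded
      (∀ t s : ℕ → ℝ, (∃ C : ℝ, ∀ n, |s n| ≤ C) →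
        ∃ R : ℝ, ∀ n,
          FloatingPlanes.dX FloatingPlanes.o (π (FloatingPlanes.γ (t n) (s n))) ≤ R) := by
  obtain ⟨π, hnear, hfoot, huniq⟩ := exists_projection
  refine ⟨π, hnear, ?_, ?_, ?_⟩
  · intro h₀ hh₀ ε hε
    refine ⟨√(3 / 2) * √(2 * (2 + 3 * (1 + 2 / (Real.exp (6 * ε) - 1)))), fun p hp => ?_⟩
    simp only [Set.mem_iUnion] at hp
    obtain ⟨t, ht, x, ⟨y, ⟨k, hk, rfl⟩, rfl⟩, rfl⟩ := hp
    obtain ⟨h, hh, hf, hπ⟩ := hfoot (h₀ * (aDiag t * k))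
    rw [smul_o, smul_mk, smul_mk, hπ]
    exact foot_close_to_geodesic hh₀ hh hk hε ht hf
  · intro ε hε t s ht _
    have hc1 : 1 < Real.cosh (3 * ε) := Real.one_lt_cosh.2 (by positivity)
    -- Here tanh² 2s < 1 for every s, and |t_n| > ε bounds 1/cosh² 3t_n by this θ.
    refine ⟨_, fun n => dX_foot_γ_le huniq (θ := 1 / Real.cosh (3 * ε) ^ 2) ?_ ?_⟩
    · rw [div_lt_one (by positivity)]
      exact one_lt_pow₀ hc1 two_ne_zero
    · have h1 : Real.cosh (3 * ε) ≤ Real.cosh (3 * t n) := by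
        rw [Real.cosh_le_cosh, abs_mul, abs_mul, abs_of_pos hε]
        gcongr
        exact (ht n).le
      have h2 : Real.cosh (3 * ε) ^ 2 ≤ Real.cosh (3 * t n) ^ 2 := by gcongr
      rw [one_div_mul_eq_div, le_div_iff₀ (by positivity), mul_pow]
      have h3 := Real.cosh_sq (2 * s n)
      exact mul_le_mul (by linarith) h2 (by positivity) (by positivity)
  · rintro t s ⟨C, hC⟩
    -- This θ is tanh² 2C; the factor cosh 3t_n ≥ 1 only helps.
    refine ⟨_, fun n => dX_foot_γ_le huniq (θ := 1 - 1 / Real.cosh (2 * C) ^ 2) ?_ ?_⟩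
    · have := Real.cosh_pos (2 * C)
      have : 0 < 1 / Real.cosh (2 * C) ^ 2 := by positivity
      linarith
    · have h1 : Real.cosh (2 * s n) ≤ Real.cosh (2 * C) := by
        rw [Real.cosh_le_cosh, abs_mul, abs_mul]
        exact mul_le_mul_of_nonneg_left ((hC n).trans (le_abs_self C)) (abs_nonneg _)
      have hp := Real.cosh_pos (2 * s n)
      have hpC := Real.cosh_pos (2 * C)
      have h2 : Real.cosh (2 * s n) ^ 2 / Real.cosh (2 * C) ^ 2 ≤ 1 := by
        rw [div_le_one (by positivity)]
        gcongr
      have h3 := Real.cosh_sq (2 * s n)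
      have h4 : 0 ≤ 1 - 1 / Real.cosh (2 * C) ^ 2 := by
        rw [sub_nonneg, div_le_one (by positivity)]
        exact one_le_pow₀ (Real.one_le_cosh _)
      calc Real.sinh (2 * s n) ^ 2 = Real.cosh (2 * s n) ^ 2 - 1 := by linarith
        _ ≤ Real.cosh (2 * s n) ^ 2 - Real.cosh (2 * s n) ^ 2 / Real.cosh (2 * C) ^ 2 := by linarith
        _ = (1 - 1 / Real.cosh (2 * C) ^ 2) * Real.cosh (2 * s n) ^ 2 := by ring
        _ ≤ _ := by
          gcongr
          exact le_mul_of_one_le_right hp.le (Real.one_le_cosh _)
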